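/- Let $N\ge 0$ be an integer, let $\eta,\zeta,\theta\in\mathbb C$ and $\lambda_1,\dots,\lambda_N,\xi_1,\dots,\xi_N\in\mathbb C$. **The model.** Let $R(u;\theta)$ be the trigonometric dynamical $R$-matrix on $\mathbb C^2\otimes\mathbb C^2$ whose non-zero entries $R^{ab}_{cd}$ (row $ab$, column $cd$, with $a,b,c,d\in\{+,-\}$) are $$R^{++}_{++}(u;\theta)=R^{--}_{--}(u;\theta)=\sinh(u+\eta),\qquad R^{+-}_{+-}(u;\theta)=R^{-+}_{-+}(u;-\theta)=\frac{\sinh u\,\sinh(\theta-\eta)}{\sinh\theta},$$ $$R^{+-}_{-+}(u;\theta)=R^{-+}_{+-}(u;-\theta)=\frac{\sinh\eta\,\sinh(\theta-u)}{\sinh\theta},$$ and let $$\mathcal K(u;\theta)=\operatorname{diag}\left(\frac{\sinh(\theta+\zeta-u)}{\sinh(\theta+\zeta+u)},\ \frac{\sinh(\zeta-u)}{\sinh(\zeta+u)}\right).$$ On $\mathbb C^2_0\otimes(\mathbb C^2)^{\otimes N}$, where the auxiliary space $\mathbb C^2_0$ carries the index $0$ and the other factors the indices $1,\dots,N$, define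 $$T(u;\theta)=R_{01}\Big(u-\xi_1;\theta-\eta\sum_{i=2}^N\sigma^z_i\Big)\cdots R_{0N}(u-\xi_N;\theta),$$ $$\widehat T(u;\theta)=R_{N0}(u+\xi_N;\theta)\cdots R_{10}\Big(u+\xi_1;\theta-\eta\sum_{i=2}^N\sigma^z_i\Big),$$ where $R_{0k}$ and $R_{k0}$ have dynamical parameter $\theta-\eta\sum_{i>k}\sigma_i^z$, and let $\mathcal B(u;\theta)$ be the $(+,-)$ block, with respect to the auxiliary space, of $T(u;\theta)\,\mathcal K(u;\theta)\,\widehat T(u;\theta)$, where $\mathcal K$ acts on the auxiliary space. The domain-wall partition function of the trigonometric SOS model with one diagonal reflecting end is $$Z_{N,2N}(\{\lambda\},\{\xi\},\theta)=\langle\bar 0|\,\mathcal B(\lambda_1;\theta)\cdots\mathcal B(\lambda_N;\theta)\,|0\rangle,$$ where $|0\rangle$ is the state with all spins up and $\langle\bar 0|$ the state with all spins down. **Genericity.** Assume that no denominator vanishes: $\sinh(\theta+m\eta)\ne0$ for all integers $m$ with $|m|<N$; $\sinh(\theta+\zeta+\lambda_i)$, $\sinh(\zeta+\lambda_i)$,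 $\sinh(\lambda_i\pm\xi_j)$ and $\sinh(\lambda_i\pm\xi_j+\eta)$ are non-zero for all $i,j$; and $\sinh(\xi_j\pm\xi_i)$, $\sinh(\lambda_j-\lambda_i)$ and $\sinh(\lambda_j+\lambda_i+\eta)$ are non-zero for all $i<j$. **Theorem.** Let $M=(M_{ij})_{1\le i,j\le N}$ be the matrix $$M_{ij}=\frac{\sinh(\theta+\zeta-\lambda_i)}{\sinh(\theta+\zeta+\lambda_i)}M^+_{ij}+\frac{\sinh(\zeta-\lambda_i)}{\sinh(\zeta+\lambda_i)}M^-_{ij},$$ $$M^{\pm}_{ij}=\frac1{\sinh(\lambda_i\mp\xi_j+\eta)}\left(\frac1{\sinh(\lambda_i\pm\xi_j)}-\frac{\sinh(\theta\mp\eta)}{\sinh\theta\,\sinh(\lambda_i\pm\xi_j+\eta)}\right).$$ Then $$Z_{N,2N}(\{\lambda\},\{\xi\},\theta)=(-1)^{N(N-1)/2}\,\det M\ \prod_{i=1}^N\frac{\sinh(\theta-i\eta)}{\sinh(\theta+(N-2i+1)\eta)}$$ $$\times\ \frac{\prod_{i,j=1}^N\sinh(\lambda_i+\xi_j)\sinh(\lambda_i-\xi_j)\sinh(\lambda_i+\xi_j+\eta)\sinh(\lambda_i-\xi_j+\eta)}{\prod_{1\le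 i<j\le N}\sinh(\xi_j+\xi_i)\sinh(\xi_j-\xi_i)\sinh(\lambda_j-\lambda_i)\sinh(\lambda_j+\lambda_i+\eta)}.$$ Moreover, for all $i,j$ the entry of $M$ has the factorised form $$M_{ij}=\frac{\sinh(\theta+\zeta+\xi_j)}{\sinh(\theta+\zeta+\lambda_i)}\cdot\frac{\sinh(\zeta-\xi_j)}{\sinh(\zeta+\lambda_i)}\cdot\frac{\sinh(2\lambda_i)\sinh\eta}{\sinh(\lambda_i-\xi_j+\eta)\sinh(\lambda_i+\xi_j+\eta)\sinh(\lambda_i-\xi_j)\sinh(\lambda_i+\xi_j)}.$$ -/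

import Mathlib

namespace SOS

/-- A spin: `0` is the spin up (`+`), `1` is the spin down (`-`). -/
abbrev Spin := Fin 2

/-- The eigenvalue of `σᶻ` on a spin: `+1` for up, `-1` for down. -/
def sz : Spin → ℂ := ![1, -1]

/-- The trigonometric dynamical `R`-matrix `R(u; θ)` with crossing parameter `η`, acting on the
tensor product of two spin spaces. The entry in the row `(a, b)` and the column `(c, d)` is the
statistical weight `R^{a b}_{c d}(u; θ)`. -/
noncomputable def RMatrix (η u θ : ℂ) : Matrix (Spin × Spin) (Spin × Spin) ℂ :=
  fun p q =>
    if p = q then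
      if p.1 = p.2 then Complex.sinh (u + η)
      else
        Complex.sinh u * Complex.sinh (sz p.1 * θ - η) / Complex.sinh (sz p.1 * θ)
    else if p = q.swap then
      Complex.sinh η * Complex.sinh (sz p.1 * θ - u) / Complex.sinh (sz p.1 * θ)
    else 0

/-- The entries `𝒦⁺₊(u; θ)` (at `0`) and `𝒦⁻₋(u; θ)` (at `1`) of the diagonal boundary matrix. -/
noncomputable def boundaryWeight (ζ u θ : ℂ) : Spin → ℂ :=
  ![Complex.sinh (θ + ζ - u) / Complex.sinh (θ + ζ + u),
    Complex.sinh (ζ - u) / Complex.sinh (ζ + u)]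

/-- Configurations of the `N` quantum spins; they index the standard basis of `(ℂ²)^{⊗ N}`. -/
abbrev Config (N : ℕ) := Fin N → Spin

/-- The index set of the standard basis of `ℂ² ⊗ (ℂ²)^{⊗ N}`, the first factor being the auxiliary
space `0`. -/
abbrev AuxConfig (N : ℕ) := Spin × Config N

/-- The value of the dynamical parameter `θ - η ∑_{i > k} σᶻ_i` on the configuration `s`. -/
noncomputable def height {N : ℕ} (η θ : ℂ) (k : Fin N) (s : Config N) : ℂ :=
  θ - η * ∑ i ∈ Finset.Ioi k, sz (s i)

/-- The operator `R_{0k}(u; θ - η ∑_{i > k} σᶻ_i)` on `ℂ² ⊗ (ℂ²)^{⊗ N}`. -/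
noncomputable def R0 {N : ℕ} (η θ u : ℂ) (k : Fin N) :
    Matrix (AuxConfig N) (AuxConfig N) ℂ :=
  fun p q =>
    if ∀ i, i ≠ k → p.2 i = q.2 i then
      RMatrix η u (height η θ k q.2) (p.1, p.2 k) (q.1, q.2 k)
    else 0

/-- The operator `R_{k0}(u; θ - η ∑_{i > k} σᶻ_i)` on `ℂ² ⊗ (ℂ²)^{⊗ N}`: the two spaces on which
the `R`-matrix acts are exchanged. -/
noncomputable def R0swap {N : ℕ} (η θ u : ℂ) (k : Fin N) :
    Matrix (AuxConfig N) (AuxConfig N) ℂ :=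
  fun p q =>
    if ∀ i, i ≠ k → p.2 i = q.2 i then
      RMatrix η u (height η θ k q.2) (p.2 k, p.1) (q.2 k, q.1)
    else 0

/-- The bulk monodromy matrix
`T(u; θ) = R_{01}(u - ξ₁; θ - η ∑_{i ≥ 2} σᶻ_i) ⋯ R_{0N}(u - ξ_N; θ)`. -/
noncomputable def monodromy {N : ℕ} (η θ : ℂ) (ξ : Fin N → ℂ) (u : ℂ) :
    Matrix (AuxConfig N) (AuxConfig N) ℂ :=
  (List.ofFn fun k => R0 η θ (u - ξ k) k).prod

/-- The reflected monodromy matrix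
`T̂(u; θ) = R_{N0}(u + ξ_N; θ) ⋯ R_{10}(u + ξ₁; θ - η ∑_{i ≥ 2} σᶻ_i)`. -/
noncomputable def monodromyHat {N : ℕ} (η θ : ℂ) (ξ : Fin N → ℂ) (u : ℂ) :
    Matrix (AuxConfig N) (AuxConfig N) ℂ :=
  (List.ofFn fun k => R0swap η θ (u + ξ k) k).reverse.prod

/-- The boundary matrix `𝒦(u; θ)` acting on the auxiliary space of `ℂ² ⊗ (ℂ²)^{⊗ N}`. -/
noncomputable def boundaryOp (N : ℕ) (ζ θ u : ℂ) : Matrix (AuxConfig N) (AuxConfig N) ℂ :=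
  Matrix.diagonal fun p => boundaryWeight ζ u θ p.1

/-- The double row monodromy matrix `𝒯(u; θ) = T(u; θ) 𝒦(u; θ) T̂(u; θ)`. -/
noncomputable def doubleRow {N : ℕ} (η ζ θ : ℂ) (ξ : Fin N → ℂ) (u : ℂ) :
    Matrix (AuxConfig N) (AuxConfig N) ℂ :=
  monodromy η θ ξ u * boundaryOp N ζ θ u * monodromyHat η θ ξ u

/-- The operator `ℬ(u; θ)` on `(ℂ²)^{⊗ N}`: the upper right block of `𝒯(u; θ)` with respect to the
auxiliary space. -/
noncomputable def opB {N : ℕ} (η ζ θ : ℂ) (ξ : Fin N → ℂ) (u : ℂ) :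
    Matrix (Config N) (Config N) ℂ :=
  fun s t => doubleRow η ζ θ ξ u (0, s) (1, t)

/-- The domain wall partition function
`Z_{N,2N}({λ}, {ξ}, θ) = ⟨0̄| ℬ(λ₁; θ) ⋯ ℬ(λ_N; θ) |0⟩`, where `|0⟩` is the state with all spins up
and `⟨0̄|` is the state with all spins down. -/
noncomputable def partitionFunction {N : ℕ} (η ζ θ : ℂ) (lam ξ : Fin N → ℂ) : ℂ :=
  (List.ofFn fun i => opB η ζ θ ξ (lam i)).prod (fun _ => 1) (fun _ => 0)

/-- The entry `M⁺_{ij}`, at `λ_i = u` and `ξ_j = x`. -/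
noncomputable def MPlus (η θ u x : ℂ) : ℂ :=
  1 / Complex.sinh (u - x + η) *
    (1 / Complex.sinh (u + x) -
      Complex.sinh (θ - η) / (Complex.sinh θ * Complex.sinh (u + x + η)))

/-- The entry `M⁻_{ij}`, at `λ_i = u` and `ξ_j = x`. -/
noncomputable def MMinus (η θ u x : ℂ) : ℂ :=
  1 / Complex.sinh (u + x + η) *
    (1 / Complex.sinh (u - x) -
      Complex.sinh (θ + η) / (Complex.sinh θ * Complex.sinh (u - x + η)))

/-- The `N × N` matrix `M`. -/
noncomputable def MMatrix {N : ℕ} (η ζ θ : ℂ) (lam ξ : Fin N → ℂ) :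
    Matrix (Fin N) (Fin N) ℂ :=
  fun i j =>
    Complex.sinh (θ + ζ - lam i) / Complex.sinh (θ + ζ + lam i) * MPlus η θ (lam i) (ξ j) +
      Complex.sinh (ζ - lam i) / Complex.sinh (ζ + lam i) * MMinus η θ (lam i) (ξ j)

end SOS

/-! This is an Izergin–Korepin argument: both sides obey the same recursion in `N`, and as functions
of the first spectral parameter `u = λ₁` they are determined by enough values. Three properties of
the partition function `Z` carry it.

Symmetry in the `ξ`'s. By the dynamical Yang–Baxter equation (`twoSite_mul_braid`,
`twoSiteHat_mul_braid`) an `R`-matrix on two neighbouring quantum sites exchanges their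
inhomogeneities in all double row operators, and the all-up and all-down states are eigenvectors of
it with a common eigenvalue (`Intertwined.swap`). The reflection equation and symmetry in the `λ`'s
are not needed, since only `λ₁` is varied.

Freezing. At `u = ξ₁` one weight vanishes, which fixes the first row and column of the lattice and
expresses `Z` through the partition function of size `N - 1` (`partitionFunction_frozen`).

Polynomiality. Only `⟨0̄| ℬ(u)` depends on `u`, and `sinh(θ+ζ+u) sinh(ζ+u) Z = sinh(2u)
p(cosh(2u+η))` with `deg p < N` (`exists_polynomial_partitionFunction`).

The closed form shares the symmetry and the recursion (`closedForm_comp`,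
`closedForm_cons_cons_self`), but in `u` it is a polynomial of degree at most `2N-2` over one of
degree `N-1`, and divisibility is not evident. So `p` is multiplied by that denominator, and two
polynomials of degree at most `2N-2` are compared at `2N-1` points: at `u = ξ_j` by symmetry,
freezing and induction, and at `u = λ_i`, `i ≥ 2`, where both vanish. The extra genericity this
requires of the `ξ`'s is removed by continuity. The factorised entries of `M` then convert `det M`
into the determinant of the closed form. -/

namespace SOS

open Matrix

/-! ### Entries of the dynamical `R`-matrix and the ice rule -/

section Weights

theorem RMatrix_up_up (η u θ : ℂ) : RMatrix η u θ (0, 0) (0, 0) = Complex.sinh (u + η) := by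
  simp [RMatrix]

theorem RMatrix_down_down (η u θ : ℂ) :
    RMatrix η u θ (1, 1) (1, 1) = Complex.sinh (u + η) := by
  simp [RMatrix]

theorem RMatrix_up_down_diag (η u θ : ℂ) :
    RMatrix η u θ (0, 1) (0, 1) =
      Complex.sinh u * Complex.sinh (θ - η) / Complex.sinh θ := by
  simp [RMatrix, sz]

theorem RMatrix_down_up_diag (η u θ : ℂ) :
    RMatrix η u θ (1, 0) (1, 0) =
      Complex.sinh u * Complex.sinh (θ + η) / Complex.sinh θ := by
  have h : -θ - η = -(θ + η) := by ring
  simp [RMatrix, sz, h, -neg_add_rev]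

theorem RMatrix_up_down_flip (η u θ : ℂ) :
    RMatrix η u θ (0, 1) (1, 0) =
      Complex.sinh η * Complex.sinh (θ - u) / Complex.sinh θ := by
  simp [RMatrix, sz]

theorem RMatrix_down_up_flip (η u θ : ℂ) :
    RMatrix η u θ (1, 0) (0, 1) =
      Complex.sinh η * Complex.sinh (θ + u) / Complex.sinh θ := by
  have h : -θ - u = -(θ + u) := by ring
  simp [RMatrix, sz, h, -neg_add_rev]

theorem sz_zero : sz 0 = 1 := rfl

theorem sz_one : sz 1 = -1 := rfl

/-- The ice rule. -/
theorem RMatrix_eq_zero (η u θ : ℂ) {p q : Spin × Spin}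
    (h : sz p.1 + sz p.2 ≠ sz q.1 + sz q.2) : RMatrix η u θ p q = 0 := by
  have h₁ : p ≠ q := fun e => h (by rw [e])
  have h₂ : p ≠ q.swap := fun e => h (by rw [e]; simp [add_comm])
  simp [RMatrix, h₁, h₂]

theorem RMatrix_zero_entries (η u θ : ℂ) :
    RMatrix η u θ (0, 0) (0, 1) = 0 ∧ RMatrix η u θ (0, 0) (1, 0) = 0 ∧
    RMatrix η u θ (0, 0) (1, 1) = 0 ∧ RMatrix η u θ (1, 1) (0, 0) = 0 ∧
    RMatrix η u θ (1, 1) (0, 1) = 0 ∧ RMatrix η u θ (1, 1) (1, 0) = 0 ∧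
    RMatrix η u θ (0, 1) (0, 0) = 0 ∧ RMatrix η u θ (0, 1) (1, 1) = 0 ∧
    RMatrix η u θ (1, 0) (0, 0) = 0 ∧ RMatrix η u θ (1, 0) (1, 1) = 0 := by
  refine ⟨?_, ?_, ?_, ?_, ?_, ?_, ?_, ?_, ?_, ?_⟩ <;> simp [RMatrix]

end Weights

/-! ### Building the double row monodromy matrix site by site -/

section Recursion

/-- The total spin of a configuration. -/
noncomputable def total {n : ℕ} (s : Config n) : ℂ := ∑ i, sz (s i)

theorem total_cons {n : ℕ} (a : Spin) (s : Config n) :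
    total (Fin.cons a s : Config (n + 1)) = sz a + total s := by
  simp [total, Fin.sum_univ_succ]

theorem height_zero {n : ℕ} (η θ : ℂ) (s : Config (n + 1)) :
    height η θ 0 s = θ - η * total (Fin.tail s) := by
  unfold height total
  congr 2
  have : Finset.Ioi (0 : Fin (n + 1)) = Finset.univ.map (Fin.succEmb n) := by
    ext i
    simp [Fin.exists_succ_eq]
  rw [this, Finset.sum_map]
  rfl

theorem height_succ {n : ℕ} (η θ : ℂ) (k : Fin n) (s : Config (n + 1)) :
    height η θ k.succ s = height η θ k (Fin.tail s) := by
  unfold height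
  congr 2
  have : Finset.Ioi k.succ = (Finset.Ioi k).map (Fin.succEmb n) := by
    ext i
    refine Fin.cases ?_ (fun j => ?_) i <;> simp
  rw [this, Finset.sum_map]
  rfl

/-- Splitting off the first site. -/
def auxSplit (n : ℕ) : AuxConfig (n + 1) ≃ AuxConfig n × Spin where
  toFun p := ((p.1, Fin.tail p.2), p.2 0)
  invFun q := (q.1.1, Fin.cons q.2 q.1.2)
  left_inv p := by simp
  right_inv q := by simp

/-- The action of an operator on the last `n` of `n + 1` sites. -/
noncomputable def auxLift (n : ℕ) :
    Matrix (AuxConfig n) (AuxConfig n) ℂ →* Matrix (AuxConfig (n + 1)) (AuxConfig (n + 1)) ℂ where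
  toFun A := (kroneckerMap (· * ·) A (1 : Matrix Spin Spin ℂ)).submatrix (auxSplit n) (auxSplit n)
  map_one' := by
    rw [one_kronecker_one, submatrix_one_equiv]
  map_mul' A B := by
    rw [submatrix_mul_equiv, ← mul_kronecker_mul, one_mul]

theorem auxLift_apply {n : ℕ} (A : Matrix (AuxConfig n) (AuxConfig n) ℂ)
    (p q : AuxConfig (n + 1)) :
    auxLift n A p q =
      if p.2 0 = q.2 0 then A (p.1, Fin.tail p.2) (q.1, Fin.tail q.2) else 0 := by
  simp [auxLift, auxSplit, kroneckerMap_apply, one_apply]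

theorem forall_ne_succ_iff {n : ℕ} (k : Fin n) (s t : Config (n + 1)) :
    (∀ i, i ≠ k.succ → s i = t i) ↔
      s 0 = t 0 ∧ ∀ i, i ≠ k → Fin.tail s i = Fin.tail t i := by
  rw [Fin.forall_fin_succ]
  simp [Fin.tail, (Fin.succ_ne_zero k).symm]

theorem R0_succ {n : ℕ} (η θ u : ℂ) (k : Fin n) :
    R0 η θ u k.succ = auxLift n (R0 η θ u k) := by
  ext p q
  rw [auxLift_apply]
  simp only [R0, forall_ne_succ_iff, height_succ, ite_and]
  rfl

theorem R0swap_succ {n : ℕ} (η θ u : ℂ) (k : Fin n) :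
    R0swap η θ u k.succ = auxLift n (R0swap η θ u k) := by
  ext p q
  rw [auxLift_apply]
  simp only [R0swap, forall_ne_succ_iff, height_succ, ite_and]
  rfl

theorem monodromy_succ {n : ℕ} (η θ : ℂ) (ξ : Fin (n + 1) → ℂ) (u : ℂ) :
    monodromy η θ ξ u = R0 η θ (u - ξ 0) 0 * auxLift n (monodromy η θ (Fin.tail ξ) u) := by
  unfold monodromy
  rw [List.ofFn_succ, List.prod_cons, map_list_prod, List.map_ofFn]
  simp only [R0_succ]
  rfl

theorem monodromyHat_succ {n : ℕ} (η θ : ℂ) (ξ : Fin (n + 1) → ℂ) (u : ℂ) :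
    monodromyHat η θ ξ u =
      auxLift n (monodromyHat η θ (Fin.tail ξ) u) * R0swap η θ (u + ξ 0) 0 := by
  unfold monodromyHat
  rw [List.ofFn_succ, List.reverse_cons, List.prod_append, List.prod_singleton, map_list_prod,
    List.map_reverse, List.map_ofFn]
  simp only [R0swap_succ]
  rfl

theorem boundaryOp_succ (n : ℕ) (ζ θ u : ℂ) :
    boundaryOp (n + 1) ζ θ u = auxLift n (boundaryOp n ζ θ u) := by
  ext p q
  rw [auxLift_apply]
  simp only [boundaryOp, diagonal_apply]
  by_cases h : p = q
  · simp [h]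
  · by_cases h0 : p.2 0 = q.2 0
    · have : ¬ (p.1, Fin.tail p.2) = (q.1, Fin.tail q.2) := fun e => h <| by
        obtain ⟨e1, e2⟩ := Prod.mk.inj e
        refine Prod.ext e1 ?_
        rw [← Fin.cons_self_tail p.2, ← Fin.cons_self_tail q.2, e2, h0]
      simp [h, this]
    · simp [h, h0]

/-- The first site carries the outermost factors of both `T` and `T̂`, and no other weight sees its
spin because heights count only the sites to the right. Hence the remaining sites form a double row
matrix with the same `θ`, nested inside. -/
theorem doubleRow_succ {n : ℕ} (η ζ θ : ℂ) (ξ : Fin (n + 1) → ℂ) (u : ℂ) :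
    doubleRow η ζ θ ξ u =
      R0 η θ (u - ξ 0) 0 * auxLift n (doubleRow η ζ θ (Fin.tail ξ) u) *
        R0swap η θ (u + ξ 0) 0 := by
  simp only [doubleRow, monodromy_succ, monodromyHat_succ, boundaryOp_succ, map_mul,
    Matrix.mul_assoc]

theorem sum_auxConfig_succ {n : ℕ} (f : AuxConfig (n + 1) → ℂ) :
    ∑ p, f p = ∑ c : Spin, ∑ m : Spin, ∑ σ : Config n, f (c, Fin.cons m σ) := by
  rw [Fintype.sum_prod_type]
  refine Finset.sum_congr rfl fun c _ => ?_
  rw [← (Fin.consEquiv fun _ : Fin (n + 1) => Spin).sum_comp, Fintype.sum_prod_type]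
  rfl

theorem forall_ne_zero_cons_iff {n : ℕ} (a b : Spin) (s t : Config n) :
    (∀ i, i ≠ 0 → (Fin.cons a s : Config (n + 1)) i = (Fin.cons b t : Config (n + 1)) i) ↔
      s = t := by
  rw [Fin.forall_fin_succ]
  simp [funext_iff]

theorem R0_zero_mul_auxLift_apply {n : ℕ} (η θ u : ℂ)
    (A : Matrix (AuxConfig n) (AuxConfig n) ℂ) (a d s t : Spin) (σ τ : Config n) :
    (R0 η θ u (0 : Fin (n + 1)) * auxLift n A : Matrix _ _ ℂ) (a, Fin.cons s σ) (d, Fin.cons t τ) =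
      ∑ c : Spin, RMatrix η u (θ - η * total σ) (a, s) (c, t) * A (c, σ) (d, τ) := by
  rw [mul_apply, sum_auxConfig_succ]
  simp [R0, auxLift_apply, height_zero, forall_ne_zero_cons_iff, -Fin.sum_univ_two]

theorem mul_R0swap_zero_apply {n : ℕ} (η θ u : ℂ)
    (A : Matrix (AuxConfig (n + 1)) (AuxConfig (n + 1)) ℂ) (p : AuxConfig (n + 1)) (b t : Spin)
    (τ : Config n) :
    (A * R0swap η θ u (0 : Fin (n + 1)) : Matrix _ _ ℂ) p (b, Fin.cons t τ) =
      ∑ d : Spin, ∑ m : Spin,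
        A p (d, Fin.cons m τ) * RMatrix η u (θ - η * total τ) (m, d) (t, b) := by
  rw [mul_apply, sum_auxConfig_succ]
  simp [R0swap, height_zero, forall_ne_zero_cons_iff, -Fin.sum_univ_two]

/-- Entrywise form of the nesting, from which the later recursions follow. The left weight sees the
height of the inner row state, the right weight that of the inner column state. -/
theorem doubleRow_cons {n : ℕ} (η ζ θ x : ℂ) (ξ : Fin n → ℂ) (u : ℂ) (a b s t : Spin)
    (σ τ : Config n) :
    doubleRow η ζ θ (Fin.cons x ξ : Fin (n + 1) → ℂ) u (a, Fin.cons s σ) (b, Fin.cons t τ) =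
      ∑ d : Spin, ∑ m : Spin, ∑ c : Spin,
        RMatrix η (u - x) (θ - η * total σ) (a, s) (c, m) *
          doubleRow η ζ θ ξ u (c, σ) (d, τ) *
            RMatrix η (u + x) (θ - η * total τ) (m, d) (t, b) := by
  rw [doubleRow_succ, mul_R0swap_zero_apply]
  simp only [R0_zero_mul_auxLift_apply, Finset.sum_mul]
  rfl

theorem doubleRow_zero (η ζ θ : ℂ) (ξ : Fin 0 → ℂ) (u : ℂ) (a b : Spin) (s t : Config 0) :
    doubleRow η ζ θ ξ u (a, s) (b, t) = if a = b then boundaryWeight ζ u θ a else 0 := by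
  have : s = t := Subsingleton.elim _ _
  simp [doubleRow, monodromy, monodromyHat, boundaryOp, one_apply, this]

/-- Conservation of the total spin. -/
theorem doubleRow_charge {n : ℕ} (η ζ θ : ℂ) (ξ : Fin n → ℂ) (u : ℂ) (a b : Spin)
    (s t : Config n) (h : sz a + total s ≠ sz b + total t) :
    doubleRow η ζ θ ξ u (a, s) (b, t) = 0 := by
  induction n generalizing a b with
  | zero =>
    rw [doubleRow_zero, if_neg]
    rintro rfl
    exact h (by rw [Subsingleton.elim s t])
  | succ n ih =>
    rw [← Fin.cons_self_tail s, ← Fin.cons_self_tail t, ← Fin.cons_self_tail ξ] at *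
    generalize s 0 = s0 at *
    generalize t 0 = t0 at *
    generalize Fin.tail s = σ at *
    generalize Fin.tail t = τ at *
    rw [doubleRow_cons]
    refine Finset.sum_eq_zero fun d _ => Finset.sum_eq_zero fun m _ =>
      Finset.sum_eq_zero fun c _ => ?_
    by_cases h1 : sz a + sz s0 = sz c + sz m
    · by_cases h2 : sz m + sz d = sz t0 + sz b
      · rw [ih (Fin.tail ξ) c d σ τ, mul_zero, zero_mul]
        intro h3
        apply h
        rw [total_cons, total_cons]
        linear_combination h1 + h2 + h3
      · rw [RMatrix_eq_zero _ _ _ (p := (m, d)) (q := (t0, b)) h2, mul_zero]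
    · rw [RMatrix_eq_zero _ _ _ (p := (a, s0)) (q := (c, m)) h1, zero_mul, zero_mul]

end Recursion

/-! ### Dynamical Yang–Baxter relations on two neighbouring sites -/

section YangBaxter

/-- The part of the bulk monodromy matrix that acts on two neighbouring sites with inhomogeneities
`x` and `y`, between the auxiliary states `a` and `c`. -/
noncomputable def twoSite (η u x y h : ℂ) (a c : Spin) :
    Matrix (Spin × Spin) (Spin × Spin) ℂ :=
  fun s m => ∑ e : Spin,
    RMatrix η (u - x) (h - η * sz s.2) (a, s.1) (e, m.1) * RMatrix η (u - y) h (e, s.2) (c, m.2)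

/-- The part of the reflected monodromy matrix that acts on two neighbouring sites. -/
noncomputable def twoSiteHat (η u x y h : ℂ) (d b : Spin) :
    Matrix (Spin × Spin) (Spin × Spin) ℂ :=
  fun m t => ∑ f : Spin,
    RMatrix η (u + y) h (m.2, d) (t.2, f) * RMatrix η (u + x) (h - η * sz t.2) (m.1, f) (t.1, b)

/-- The dynamical `R`-matrix composed with the exchange of the two factors. -/
noncomputable def braid (η u h : ℂ) : Matrix (Spin × Spin) (Spin × Spin) ℂ :=
  fun s t => RMatrix η u h s t.swap

/-- The dynamical Yang–Baxter equation in components: pulling the exchange operator through the row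
shifts its height by the auxiliary spin `c`. It is checked entry by entry, as identities between
exponentials. -/
theorem twoSite_mul_braid (η u x y h : ℂ) (a c : Spin) (h₀ : Complex.sinh h ≠ 0)
    (h₁ : Complex.sinh (h - η) ≠ 0) (h₂ : Complex.sinh (h + η) ≠ 0) :
    twoSite η u x y h a c * braid η (x - y) (h - η * sz c) =
      braid η (x - y) h * twoSite η u y x h a c := by
  -- Only differences of `u`, `x`, `y` occur; after this substitution they are the free variables.
  obtain ⟨p, rfl⟩ : ∃ p, u = p + x := ⟨u - x, by ring⟩
  obtain ⟨q, rfl⟩ : ∃ q, x = q + y := ⟨x - y, by ring⟩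
  ext ⟨s₁, s₂⟩ ⟨t₁, t₂⟩
  simp only [mul_apply, Fintype.sum_prod_type, Fin.sum_univ_two, twoSite, braid, Prod.swap_prod_mk]
  fin_cases a <;> fin_cases c <;> fin_cases s₁ <;> fin_cases s₂ <;> fin_cases t₁ <;>
    fin_cases t₂ <;>
    simp only [Fin.zero_eta, Fin.mk_one, RMatrix_zero_entries, mul_zero, zero_mul,
      add_zero, zero_add, RMatrix_up_up, RMatrix_down_down, RMatrix_up_down_diag,
      RMatrix_down_up_diag, RMatrix_up_down_flip, RMatrix_down_up_flip, sz_zero, sz_one, mul_one,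
      mul_neg, sub_neg_eq_add, add_sub_cancel_right, sub_add_cancel] <;>
    field_simp <;>
    (try simp only [Complex.sinh, Complex.exp_add, sub_eq_add_neg, neg_add, neg_neg,
      Complex.exp_neg]) <;>
    (try field_simp) <;> ring

theorem twoSiteHat_mul_braid (η u x y h : ℂ) (d b : Spin) (h₀ : Complex.sinh h ≠ 0)
    (h₁ : Complex.sinh (h - η) ≠ 0) (h₂ : Complex.sinh (h + η) ≠ 0) :
    twoSiteHat η u x y h d b * braid η (x - y) h =
      braid η (x - y) (h - η * sz d) * twoSiteHat η u y x h d b := by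
  obtain ⟨p, rfl⟩ : ∃ p, u = p - x := ⟨u + x, by ring⟩
  obtain ⟨q, rfl⟩ : ∃ q, x = q + y := ⟨x - y, by ring⟩
  ext ⟨s₁, s₂⟩ ⟨t₁, t₂⟩
  simp only [mul_apply, Fintype.sum_prod_type, Fin.sum_univ_two, twoSiteHat, braid, Prod.swap_prod_mk]
  fin_cases d <;> fin_cases b <;> fin_cases s₁ <;> fin_cases s₂ <;> fin_cases t₁ <;>
    fin_cases t₂ <;>
    simp only [Fin.zero_eta, Fin.mk_one, RMatrix_zero_entries, mul_zero, zero_mul,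
      add_zero, zero_add, RMatrix_up_up, RMatrix_down_down, RMatrix_up_down_diag,
      RMatrix_down_up_diag, RMatrix_up_down_flip, RMatrix_down_up_flip, sz_zero, sz_one, mul_one,
      mul_neg, sub_neg_eq_add, add_sub_cancel_right, sub_add_cancel] <;>
    field_simp <;>
    (try simp only [Complex.sinh, Complex.exp_add, sub_eq_add_neg, neg_add, neg_neg,
      Complex.exp_neg]) <;>
    (try field_simp) <;> ring

theorem doubleRow_cons_cons {n : ℕ} (η ζ θ x y : ℂ) (ξ : Fin n → ℂ) (u : ℂ)
    (a b s₁ s₂ t₁ t₂ : Spin) (σ τ : Config n) :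
    doubleRow η ζ θ (Fin.cons x (Fin.cons y ξ : Fin (n + 1) → ℂ) : Fin (n + 2) → ℂ) u
        (a, Fin.cons s₁ (Fin.cons s₂ σ : Config (n + 1)))
        (b, Fin.cons t₁ (Fin.cons t₂ τ : Config (n + 1))) =
      ∑ c : Spin, ∑ d : Spin, doubleRow η ζ θ ξ u (c, σ) (d, τ) *
        (twoSite η u x y (θ - η * total σ) a c * twoSiteHat η u x y (θ - η * total τ) d b)
          (s₁, s₂) (t₁, t₂) := by
  have e : ∀ (r : Spin) (ρ : Config n),
      θ - η * (sz r + total ρ) = θ - η * total ρ - η * sz r := fun r ρ => by ring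
  simp only [doubleRow_cons, total_cons, e, mul_apply, Fintype.sum_prod_type, Fin.sum_univ_two,
    twoSite, twoSiteHat]
  ring

end YangBaxter

/-! ### Exchanging inhomogeneities by conjugation -/

section Intertwining

/-- The operator on the quantum spins between the auxiliary states `a` and `b`. -/
noncomputable def block {n : ℕ} (η ζ θ : ℂ) (ξ : Fin n → ℂ) (u : ℂ) (a b : Spin) :
    Matrix (Config n) (Config n) ℂ :=
  fun s t => doubleRow η ζ θ ξ u (a, s) (b, t)

/-- The state with all spins up. -/
def allUp (n : ℕ) : Config n := fun _ => 0

/-- The state with all spins down. -/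
def allDown (n : ℕ) : Config n := fun _ => 1

theorem allUp_succ (n : ℕ) : allUp (n + 1) = Fin.cons 0 (allUp n) := by
  ext i; refine Fin.cases ?_ (fun j => ?_) i <;> rfl

theorem allDown_succ (n : ℕ) : allDown (n + 1) = Fin.cons 1 (allDown n) := by
  ext i; refine Fin.cases ?_ (fun j => ?_) i <;> rfl

theorem exists_total_eq_intCast {n : ℕ} (s : Config n) : ∃ k : ℤ, |k| ≤ n ∧ total s = k := by
  induction n with
  | zero => exact ⟨0, by simp, by simp [total]⟩
  | succ n ih =>
    obtain ⟨k, hk, e⟩ := ih (Fin.tail s)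
    rw [← Fin.cons_self_tail s, total_cons, e]
    rw [abs_le] at hk
    generalize s 0 = r
    fin_cases r
    · refine ⟨k + 1, ?_, ?_⟩
      · rw [abs_le]; push_cast; constructor <;> linarith
      · simp [sz_zero, add_comm]
    · refine ⟨k - 1, ?_, ?_⟩
      · rw [abs_le]; push_cast; constructor <;> linarith
      · simp [sz_one]; ring

theorem sum_config_succ {n : ℕ} (f : Config (n + 1) → ℂ) :
    ∑ s, f s = ∑ m : Spin, ∑ σ : Config n, f (Fin.cons m σ) := by
  rw [← (Fin.consEquiv fun _ : Fin (n + 1) => Spin).sum_comp, Fintype.sum_prod_type]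
  rfl

/-- The double row operators with inhomogeneities `ξ` and `ξ'` are conjugate by an operator that
preserves the total spin and for which the two ferromagnetic states are eigenvectors with the same
non-zero eigenvalue. -/
def Intertwined {n : ℕ} (η ζ θ : ℂ) (ξ ξ' : Fin n → ℂ) : Prop :=
  ∃ W : Matrix (Config n) (Config n) ℂ, ∃ w : ℂ, w ≠ 0 ∧
    (∀ s t, total s ≠ total t → W s t = 0) ∧
    (∀ u a b, block η ζ θ ξ u a b * W = W * block η ζ θ ξ' u a b) ∧
    (∀ s, W (allDown n) s = if allDown n = s then w else 0) ∧
    ∀ s, W s (allUp n) = if s = allUp n then w else 0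

theorem Intertwined.refl {n : ℕ} (η ζ θ : ℂ) (ξ : Fin n → ℂ) : Intertwined η ζ θ ξ ξ :=
  ⟨1, 1, one_ne_zero, fun s t h => one_apply_ne fun e => h (by rw [e]), fun u a b => by simp,
    fun s => one_apply, fun s => one_apply⟩

theorem Intertwined.trans {n : ℕ} {η ζ θ : ℂ} {ξ ξ' ξ'' : Fin n → ℂ}
    (h : Intertwined η ζ θ ξ ξ') (h' : Intertwined η ζ θ ξ' ξ'') : Intertwined η ζ θ ξ ξ'' := by
  obtain ⟨W, w, hw, hc, hb, hd, hu⟩ := h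
  obtain ⟨V, v, hv, hc', hb', hd', hu'⟩ := h'
  refine ⟨W * V, w * v, mul_ne_zero hw hv, fun s t hst => ?_, fun u a b => ?_, fun s => ?_,
    fun s => ?_⟩
  · rw [mul_apply]
    refine Finset.sum_eq_zero fun r _ => ?_
    by_cases e : total s = total r
    · rw [hc' r t (e ▸ hst), mul_zero]
    · rw [hc s r e, zero_mul]
  · rw [← Matrix.mul_assoc, hb, Matrix.mul_assoc, hb', Matrix.mul_assoc]
  · simp [mul_apply, hd, hd']
  · simp [mul_apply, hu, hu', mul_comm]

/-- The operator `W` on the inner sites also works with a further outer site: the outer weights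
depend on the inner spins only through their total, which `W` preserves. -/
theorem Intertwined.cons {n : ℕ} {η ζ θ : ℂ} {ξ ξ' : Fin n → ℂ} (x : ℂ)
    (h : Intertwined η ζ θ ξ ξ') :
    Intertwined η ζ θ (Fin.cons x ξ : Fin (n + 1) → ℂ) (Fin.cons x ξ') := by
  obtain ⟨W, w, hw, hc, hb, hd, hu⟩ := h
  refine ⟨of fun s t => if s 0 = t 0 then W (Fin.tail s) (Fin.tail t) else 0, w, hw,
    fun s t hst => ?_, fun u a b => ?_, fun s => ?_, fun s => ?_⟩
  · rw [of_apply]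
    split_ifs with e
    · refine hc _ _ fun e' => hst ?_
      rw [← Fin.cons_self_tail s, ← Fin.cons_self_tail t, total_cons, total_cons, e, e']
    · rfl
  · ext s t
    obtain ⟨s, σ, rfl⟩ : ∃ r ρ, s = Fin.cons r ρ := ⟨_, _, (Fin.cons_self_tail s).symm⟩
    obtain ⟨t, τ, rfl⟩ : ∃ r ρ, t = Fin.cons r ρ := ⟨_, _, (Fin.cons_self_tail t).symm⟩
    simp only [mul_apply, of_apply, sum_config_succ, block, Fin.cons_zero, Fin.tail_cons, doubleRow_cons,
      mul_ite, ite_mul, mul_zero, zero_mul]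
    -- The summations are reordered so that, for fixed intermediate spins `d`, `m`, `c`, the inner
    -- relation `hb` applies.
    rw [Finset.sum_comm, Finset.sum_comm (s := Finset.univ (α := Spin)) (t := Finset.univ (α := Config n))]
    simp only [Finset.sum_ite_eq, Finset.sum_ite_eq', Finset.mem_univ, if_true, Finset.sum_mul,
      Finset.mul_sum]
    rw [Finset.sum_comm, Finset.sum_comm (s := Finset.univ (α := Config n))]
    refine Finset.sum_congr rfl fun d _ => ?_
    rw [Finset.sum_comm, Finset.sum_comm (s := Finset.univ (α := Config n))]
    refine Finset.sum_congr rfl fun m _ => ?_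
    rw [Finset.sum_comm, Finset.sum_comm (s := Finset.univ (α := Config n))]
    refine Finset.sum_congr rfl fun c _ => ?_
    have key := congrFun (congrFun (hb u c d) σ) τ
    simp only [mul_apply, block] at key
    trans RMatrix η (u - x) (θ - η * total σ) (a, s) (c, m) *
      (∑ ρ, doubleRow η ζ θ ξ u (c, σ) (d, ρ) * W ρ τ) *
        RMatrix η (u + x) (θ - η * total τ) (m, d) (t, b)
    · rw [Finset.mul_sum, Finset.sum_mul]
      refine Finset.sum_congr rfl fun ρ _ => ?_
      by_cases e : total ρ = total τ
      · rw [e]; ring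
      · rw [hc _ _ e]; ring
    · rw [key, Finset.mul_sum, Finset.sum_mul]
      refine Finset.sum_congr rfl fun ρ _ => ?_
      by_cases e : total σ = total ρ
      · rw [e]; ring
      · rw [hc _ _ e]; ring
  · obtain ⟨s, σ, rfl⟩ : ∃ r ρ, s = Fin.cons r ρ := ⟨_, _, (Fin.cons_self_tail s).symm⟩
    simp only [of_apply, allDown_succ, Fin.cons_zero, Fin.tail_cons, hd, Fin.cons_inj, ite_and]
  · obtain ⟨s, σ, rfl⟩ : ∃ r ρ, s = Fin.cons r ρ := ⟨_, _, (Fin.cons_self_tail s).symm⟩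
    simp only [of_apply, allUp_succ, Fin.cons_zero, Fin.tail_cons, hu, Fin.cons_inj, ite_and]

theorem Intertwined.swap {n : ℕ} {η ζ θ : ℂ} (ξ : Fin n → ℂ) {x y : ℂ}
    (hθ : ∀ m : ℤ, |m| < ((n + 2 : ℕ) : ℤ) → Complex.sinh (θ + m * η) ≠ 0)
    (hxy : Complex.sinh (x - y + η) ≠ 0) :
    Intertwined η ζ θ (Fin.cons x (Fin.cons y ξ : Fin (n + 1) → ℂ) : Fin (n + 2) → ℂ)
      (Fin.cons y (Fin.cons x ξ : Fin (n + 1) → ℂ)) := by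
  -- The total spin of `n` sites is an integer in `[-n, n]`, so the heights and their shifts by `±η`
  -- have the form `θ + mη` with `|m| ≤ n + 1`.
  have hh : ∀ σ : Config n, Complex.sinh (θ - η * total σ) ≠ 0 ∧
      Complex.sinh (θ - η * total σ - η) ≠ 0 ∧ Complex.sinh (θ - η * total σ + η) ≠ 0 := by
    intro σ
    obtain ⟨k, hk, e⟩ := exists_total_eq_intCast σ
    rw [abs_le] at hk
    have h : ∀ j : ℤ, |j| < ((n + 2 : ℕ) : ℤ) → ∀ z, z = θ + j * η → Complex.sinh z ≠ 0 := by
      rintro j hj z rfl; exact hθ j hj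
    refine ⟨h (-k) ?_ _ ?_, h (-k - 1) ?_ _ ?_, h (-k + 1) ?_ _ ?_⟩ <;>
      first
      | (rw [abs_lt]; push_cast; constructor <;> linarith)
      | (rw [e]; push_cast; ring)
  -- The intertwiner is the exchange operator on the first two sites, at the height set by the
  -- others. On two equal spins it is the scalar `sinh(x - y + η)`, which is the common eigenvalue.
  refine ⟨of fun s t => if Fin.tail (Fin.tail s) = Fin.tail (Fin.tail t) then
      braid η (x - y) (θ - η * total (Fin.tail (Fin.tail s))) (s 0, Fin.tail s 0)
        (t 0, Fin.tail t 0) else 0, Complex.sinh (x - y + η), hxy,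
    fun s t hst => ?_, fun u a b => ?_, fun s => ?_, fun s => ?_⟩
  · rw [of_apply]
    split_ifs with e
    · refine RMatrix_eq_zero _ _ _ fun e' => hst ?_
      rw [← Fin.cons_self_tail s, ← Fin.cons_self_tail t, ← Fin.cons_self_tail (Fin.tail s),
        ← Fin.cons_self_tail (Fin.tail t)]
      simp only [total_cons, e]
      simp only [Prod.swap_prod_mk] at e'
      linear_combination e'
    · rfl
  · ext s t
    obtain ⟨s₁, s₂, σ, rfl⟩ : ∃ r r' ρ, s = Fin.cons r (Fin.cons r' ρ : Config (n + 1)) :=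
      ⟨s 0, Fin.tail s 0, _, by rw [Fin.cons_self_tail, Fin.cons_self_tail]⟩
    obtain ⟨t₁, t₂, τ, rfl⟩ : ∃ r r' ρ, t = Fin.cons r (Fin.cons r' ρ : Config (n + 1)) :=
      ⟨t 0, Fin.tail t 0, _, by rw [Fin.cons_self_tail, Fin.cons_self_tail]⟩
    simp only [mul_apply, of_apply, sum_config_succ, block, Fin.cons_zero, Fin.tail_cons,
      mul_ite, ite_mul, mul_zero, zero_mul, Finset.sum_ite_eq, Finset.sum_ite_eq',
      Finset.mem_univ, if_true]
    simp only [doubleRow_cons_cons]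
    trans ∑ c : Spin, ∑ d : Spin, doubleRow η ζ θ ξ u (c, σ) (d, τ) *
        (twoSite η u x y (θ - η * total σ) a c * twoSiteHat η u x y (θ - η * total τ) d b *
          braid η (x - y) (θ - η * total τ)) (s₁, s₂) (t₁, t₂)
    · simp only [mul_apply (N := braid _ _ _), Fintype.sum_prod_type, Fin.sum_univ_two]
      ring
    trans ∑ c : Spin, ∑ d : Spin, doubleRow η ζ θ ξ u (c, σ) (d, τ) *
        (braid η (x - y) (θ - η * total σ) * (twoSite η u y x (θ - η * total σ) a c *
          twoSiteHat η u y x (θ - η * total τ) d b)) (s₁, s₂) (t₁, t₂)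
    · refine Finset.sum_congr rfl fun c _ => Finset.sum_congr rfl fun d _ => ?_
      by_cases e : sz c + total σ = sz d + total τ
      · obtain ⟨k₀, k₁, k₂⟩ := hh σ
        obtain ⟨l₀, l₁, l₂⟩ := hh τ
        -- Spin conservation of the inner block makes the shifted height left by the `T̂` relation
        -- equal to the one required by the `T` relation.
        have e' : θ - η * total τ - η * sz d = θ - η * total σ - η * sz c := by
          linear_combination η * e
        rw [Matrix.mul_assoc, twoSiteHat_mul_braid _ _ _ _ _ _ _ l₀ l₁ l₂, e',
          ← Matrix.mul_assoc, twoSite_mul_braid _ _ _ _ _ _ _ k₀ k₁ k₂, Matrix.mul_assoc]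
      · rw [doubleRow_charge _ _ _ _ _ _ _ _ _ e, zero_mul, zero_mul]
    · simp only [mul_apply (M := braid _ _ _), Fintype.sum_prod_type, Fin.sum_univ_two]
      ring
  · obtain ⟨s₁, s₂, σ, rfl⟩ : ∃ r r' ρ, s = Fin.cons r (Fin.cons r' ρ : Config (n + 1)) :=
      ⟨s 0, Fin.tail s 0, _, by rw [Fin.cons_self_tail, Fin.cons_self_tail]⟩
    simp only [of_apply, allDown_succ, Fin.cons_zero, Fin.tail_cons, Fin.cons_inj]
    fin_cases s₁ <;> fin_cases s₂ <;>
      simp [braid, RMatrix_zero_entries, RMatrix_down_down]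
  · obtain ⟨s₁, s₂, σ, rfl⟩ : ∃ r r' ρ, s = Fin.cons r (Fin.cons r' ρ : Config (n + 1)) :=
      ⟨s 0, Fin.tail s 0, _, by rw [Fin.cons_self_tail, Fin.cons_self_tail]⟩
    simp only [of_apply, allUp_succ, Fin.cons_zero, Fin.tail_cons, Fin.cons_inj]
    fin_cases s₁ <;> fin_cases s₂ <;>
      simp [braid, RMatrix_zero_entries, RMatrix_up_up]

/-- Any inhomogeneity can be moved to the first site. -/
theorem Intertwined.move_to_front {n : ℕ} {η ζ θ : ℂ} (ξ : Fin (n + 1) → ℂ)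
    (hθ : ∀ m : ℤ, |m| < ((n + 1 : ℕ) : ℤ) → Complex.sinh (θ + m * η) ≠ 0)
    (hξ : ∀ i j, i ≠ j → Complex.sinh (ξ i - ξ j + η) ≠ 0) (j : Fin (n + 1)) :
    Intertwined η ζ θ ξ (Fin.cons (ξ j) fun i => ξ (j.succAbove i)) := by
  have zero_case : ∀ {m : ℕ} (ξ : Fin (m + 1) → ℂ),
      Intertwined η ζ θ ξ (Fin.cons (ξ 0) fun i => ξ ((0 : Fin (m + 1)).succAbove i)) := by
    intro m ξ
    have : (Fin.cons (ξ 0) fun i => ξ ((0 : Fin (m + 1)).succAbove i) : Fin (m + 1) → ℂ) = ξ := by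
      ext i
      refine Fin.cases ?_ (fun i => ?_) i <;> simp
    rw [this]
    exact .refl _ _ _ _
  induction n with
  | zero => rw [Fin.fin_one_eq_zero j]; exact zero_case ξ
  | succ n ih =>
    refine Fin.cases (zero_case ξ) (fun k => ?_) j
    have h₁ := (ih (Fin.tail ξ) (fun m hm => hθ m (hm.trans (by push_cast; linarith)))
      (fun i j hij => hξ _ _ fun e => hij (Fin.succ_injective _ e)) k).cons (ξ 0)
    rw [Fin.cons_self_tail] at h₁
    have h₂ := Intertwined.swap (η := η) (ζ := ζ) (θ := θ)
      (fun i => Fin.tail ξ (k.succAbove i)) hθ (hξ 0 k.succ (Fin.succ_ne_zero k).symm)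
    have e : (Fin.cons (ξ k.succ) fun i => ξ (k.succ.succAbove i) : Fin (n + 2) → ℂ) =
        Fin.cons (ξ k.succ) (Fin.cons (ξ 0) fun i => Fin.tail ξ (k.succAbove i) :
          Fin (n + 1) → ℂ) := by
      ext i
      refine Fin.cases rfl (fun i => ?_) i
      refine Fin.cases ?_ (fun i => ?_) i <;> simp [Fin.tail]
    rw [e]
    exact h₁.trans h₂

end Intertwining

/-! ### Freezing at `λ₁ = ξ₁` and the resulting recursion -/

section Freezing

/-- The product of the operators `ℬ` at the spectral parameters in a list. -/
noncomputable def opProd {n : ℕ} (η ζ θ : ℂ) (ξ : Fin n → ℂ) (L : List ℂ) :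
    Matrix (Config n) (Config n) ℂ :=
  (L.map (opB η ζ θ ξ)).prod

theorem partitionFunction_eq_opProd {n : ℕ} (η ζ θ : ℂ) (lam ξ : Fin n → ℂ) :
    partitionFunction η ζ θ lam ξ = opProd η ζ θ ξ (List.ofFn lam) (allDown n) (allUp n) := by
  rw [opProd, List.map_ofFn]
  rfl

theorem opProd_cons {n : ℕ} (η ζ θ : ℂ) (ξ : Fin n → ℂ) (u : ℂ) (L : List ℂ) :
    opProd η ζ θ ξ (u :: L) = opB η ζ θ ξ u * opProd η ζ θ ξ L := by
  simp [opProd]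

/-- Take the matrix element of the conjugation relation between all-down and all-up. Only the common
non-zero eigenvalue `w` has to be cancelled; invertibility of `W` plays no role. -/
theorem Intertwined.partitionFunction_eq {n : ℕ} {η ζ θ : ℂ} {ξ ξ' : Fin n → ℂ}
    (h : Intertwined η ζ θ ξ ξ') (lam : Fin n → ℂ) :
    partitionFunction η ζ θ lam ξ = partitionFunction η ζ θ lam ξ' := by
  obtain ⟨W, w, hw, -, hb, hd, hu⟩ := h
  have key : ∀ L : List ℂ, opProd η ζ θ ξ L * W = W * opProd η ζ θ ξ' L := by
    intro L
    induction L with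
    | nil => simp [opProd]
    | cons u L ih =>
      have := hb u 0 1
      change opB η ζ θ ξ u * W = W * opB η ζ θ ξ' u at this
      rw [opProd_cons, opProd_cons, Matrix.mul_assoc, ih, ← Matrix.mul_assoc, this,
        Matrix.mul_assoc]
  have := congrFun (congrFun (key (List.ofFn lam)) (allDown n)) (allUp n)
  simp only [mul_apply, hd, hu, mul_ite, ite_mul, mul_zero, zero_mul, Finset.sum_ite_eq,
    Finset.sum_ite_eq', Finset.mem_univ, if_true] at this
  rw [partitionFunction_eq_opProd, partitionFunction_eq_opProd]
  exact mul_right_cancel₀ hw (this.trans (mul_comm _ _))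

/-- By the ice rule, an up auxiliary spin meeting an up first spin leaves both unchanged, and the
returning auxiliary spin must then be down. The first site stays up and contributes a scalar. -/
theorem opB_cons_up {n : ℕ} (η ζ θ x : ℂ) (ξ : Fin n → ℂ) (u : ℂ) (t : Spin) (σ τ : Config n) :
    opB η ζ θ (Fin.cons x ξ : Fin (n + 1) → ℂ) u (Fin.cons 0 σ) (Fin.cons t τ) =
      if t = 0 then
        Complex.sinh (u - x + η) * Complex.sinh (u + x) *
          (Complex.sinh (θ - η * (total τ + 1)) / Complex.sinh (θ - η * total τ)) *
          opB η ζ θ ξ u σ τ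
      else 0 := by
  have e : θ - η * (total τ + 1) = θ - η * total τ - η := by ring
  unfold opB
  rw [doubleRow_cons, e]
  fin_cases t <;>
    simp [Fin.sum_univ_two, RMatrix_zero_entries, RMatrix_up_up, RMatrix_up_down_diag]
  ring

theorem opB_charge {n : ℕ} (η ζ θ : ℂ) (ξ : Fin n → ℂ) (u : ℂ) (σ τ : Config n)
    (h : total τ ≠ total σ + 2) : opB η ζ θ ξ u σ τ = 0 := by
  refine doubleRow_charge _ _ _ _ _ _ _ _ _ fun e => h ?_
  rw [sz_zero, sz_one] at e
  linear_combination -e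

/-- Each `ℬ` raises the total spin by `2`, so the height at every step, and with it the scalar of
the frozen site, is known independently of the path. -/
theorem opProd_cons_up {n : ℕ} (η ζ θ x : ℂ) (ξ : Fin n → ℂ) (L : List ℂ) (t : Spin)
    (σ τ : Config n) :
    opProd η ζ θ (Fin.cons x ξ : Fin (n + 1) → ℂ) L (Fin.cons 0 σ) (Fin.cons t τ) =
      if t = 0 then
        (L.map fun u => Complex.sinh (u - x + η) * Complex.sinh (u + x)).prod *
          (∏ i ∈ Finset.range L.length,
            Complex.sinh (θ - η * (total σ + 2 * (i + 1) + 1)) /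
              Complex.sinh (θ - η * (total σ + 2 * (i + 1)))) *
          opProd η ζ θ ξ L σ τ
      else 0 := by
  induction L generalizing σ with
  | nil =>
    have : (0 : Spin) = t ↔ t = 0 := eq_comm
    simp [opProd, one_apply, Fin.cons_inj, ite_and, this]
  | cons u L ih =>
    rw [opProd_cons, mul_apply, sum_config_succ]
    simp only [opB_cons_up, ite_mul, zero_mul]
    rw [Fin.sum_univ_two]
    simp only [ih, if_true, one_ne_zero, if_false, Finset.sum_const_zero, add_zero, mul_ite,
      mul_zero]
    split_ifs with ht
    · rw [opProd_cons, mul_apply, Finset.mul_sum]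
      refine Finset.sum_congr rfl fun ρ _ => ?_
      by_cases hρ : total ρ = total σ + 2
      · rw [List.map_cons, List.prod_cons, List.length_cons, Finset.prod_range_succ', hρ]
        have e : ∀ i : ℕ, total σ + 2 + 2 * ((i : ℂ) + 1) =
            total σ + 2 * (((i + 1 : ℕ) : ℂ) + 1) := fun i => by push_cast; ring
        simp only [e, Nat.cast_zero, zero_add, mul_one]
        ring
      · rw [opB_charge _ _ _ _ _ _ _ hρ]
        ring
    · simp

theorem total_eq_card {n : ℕ} (s : Config n) :
    total s = 2 * ((Finset.univ.filter fun i => s i = 0).card : ℂ) - n := by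
  have h : ∀ r : Spin, sz r = 2 * (if r = 0 then 1 else 0) - 1 := by
    intro r
    fin_cases r <;> simp [sz]
    norm_num
  simp only [total, h, Finset.sum_sub_distrib, ← Finset.mul_sum, Finset.sum_boole]
  simp

theorem total_allDown (n : ℕ) : total (allDown n) = -n := by
  simp [total, allDown, sz_one]

theorem eq_allDown_of_total_eq {n : ℕ} {s : Config n} (h : total s = -n) : s = allDown n := by
  rw [total_eq_card] at h
  have : ((Finset.univ.filter fun i => s i = 0).card : ℂ) = 0 := by linear_combination h / 2
  have h0 : (Finset.univ.filter fun i => s i = 0) = ∅ :=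
    Finset.card_eq_zero.mp (by exact_mod_cast this)
  funext i
  have hi : s i ≠ 0 := fun e => by
    have : i ∈ Finset.univ.filter fun i => s i = 0 := by simp [e]
    simp [h0] at this
  exact Fin.eq_one_of_ne_zero _ hi

theorem total_ne {n : ℕ} (s : Config n) : total s ≠ -n - 2 := by
  intro h
  rw [total_eq_card] at h
  have : (((Finset.univ.filter fun i => s i = 0).card + 1 : ℕ) : ℂ) = 0 := by
    push_cast
    linear_combination h / 2
  exact absurd this (Nat.cast_ne_zero.mpr (Nat.succ_ne_zero _))

theorem block_diag_allDown {n : ℕ} (η ζ θ : ℂ) (ξ : Fin n → ℂ) (u : ℂ) (a : Spin)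
    {τ : Config n} (h : τ ≠ allDown n) : block η ζ θ ξ u a a (allDown n) τ = 0 := by
  refine doubleRow_charge _ _ _ _ _ _ _ _ _ fun e => h (eq_allDown_of_total_eq ?_)
  rw [total_allDown] at e
  linear_combination -e

theorem block_down_up_allDown {n : ℕ} (η ζ θ : ℂ) (ξ : Fin n → ℂ) (u : ℂ) (τ : Config n) :
    block η ζ θ ξ u 1 0 (allDown n) τ = 0 := by
  refine doubleRow_charge _ _ _ _ _ _ _ _ _ fun e => total_ne τ ?_
  rw [total_allDown, sz_zero, sz_one] at e
  linear_combination -e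

theorem block_down_allDown {n : ℕ} (η ζ θ : ℂ) (ξ : Fin n → ℂ) (u : ℂ) :
    block η ζ θ ξ u 1 1 (allDown n) (allDown n) =
      Complex.sinh (ζ - u) / Complex.sinh (ζ + u) *
        ∏ k, Complex.sinh (u - ξ k + η) * Complex.sinh (u + ξ k + η) := by
  induction n with
  | zero =>
    unfold block
    simp [doubleRow_zero, boundaryWeight]
  | succ n ih =>
    have hh := block_down_up_allDown η ζ θ (Fin.tail ξ) u (allDown n)
    have ih := ih (Fin.tail ξ)
    rw [← Fin.cons_self_tail ξ]
    unfold block at *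
    rw [allDown_succ, doubleRow_cons, Fin.prod_univ_succ]
    simp [Fin.sum_univ_two, RMatrix_zero_entries, RMatrix_down_down, ih]
    ring

/-- At `u = x` the diagonal weight `sinh(u - x)` vanishes, so the up auxiliary spin must be
exchanged with the first site. The inner sites then see the state of lowest total spin, which admits
a single continuation. -/
theorem opB_allDown_frozen {n : ℕ} (η ζ θ x : ℂ) (ξ : Fin n → ℂ) (t : Spin) (τ : Config n)
    (h : Complex.sinh (θ + n * η) ≠ 0) :
    opB η ζ θ (Fin.cons x ξ : Fin (n + 1) → ℂ) x (allDown (n + 1)) (Fin.cons t τ) =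
      if t = 0 ∧ τ = allDown n then
        Complex.sinh η * Complex.sinh (2 * x) *
          (Complex.sinh (θ + (n - 1) * η) / Complex.sinh (θ + n * η)) *
          (Complex.sinh (ζ - x) / Complex.sinh (ζ + x) *
            ∏ k, Complex.sinh (x - ξ k + η) * Complex.sinh (x + ξ k + η))
      else 0 := by
  have e : θ - η * total (allDown n) = θ + n * η := by rw [total_allDown]; ring
  have e' : θ + n * η - η = θ + (n - 1) * η := by ring
  have hD := block_down_allDown η ζ θ ξ x
  have h0 : ∀ τ, τ ≠ allDown n → block η ζ θ ξ x 1 1 (allDown n) τ = 0 :=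
    fun τ => block_diag_allDown η ζ θ ξ x 1
  unfold opB
  unfold block at hD h0
  rw [allDown_succ, doubleRow_cons, e, sub_self]
  by_cases hτ : τ = allDown n
  · subst hτ
    rw [e]
    fin_cases t
    · simp [Fin.sum_univ_two, RMatrix_zero_entries, RMatrix_up_down_diag, RMatrix_up_down_flip,
        hD, e', ← two_mul]
      field_simp
    · simp [Fin.sum_univ_two, RMatrix_zero_entries, RMatrix_up_down_diag, RMatrix_up_down_flip]
  · fin_cases t <;> simp [Fin.sum_univ_two, RMatrix_zero_entries, RMatrix_up_down_diag,
      RMatrix_up_down_flip, h0 τ hτ, hτ]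

/-- The partition function at a spectral parameter at which the first row and the first column
are frozen. -/
theorem partitionFunction_frozen {n : ℕ} (η ζ θ x : ℂ) (lam ξ : Fin n → ℂ)
    (h : Complex.sinh (θ + n * η) ≠ 0) :
    partitionFunction η ζ θ (Fin.cons x lam : Fin (n + 1) → ℂ) (Fin.cons x ξ) =
      Complex.sinh η * Complex.sinh (2 * x) * (Complex.sinh (ζ - x) / Complex.sinh (ζ + x)) *
        (∏ k, Complex.sinh (x - ξ k + η) * Complex.sinh (x + ξ k + η)) *
        (∏ k, Complex.sinh (lam k - x + η) * Complex.sinh (lam k + x)) *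
        (∏ i ∈ Finset.range (n + 1),
          Complex.sinh (θ + (n - 2 * i - 1) * η) / Complex.sinh (θ + (n - 2 * i) * η)) *
        partitionFunction η ζ θ lam ξ := by
  rw [partitionFunction_eq_opProd, partitionFunction_eq_opProd, List.ofFn_cons, opProd_cons,
    mul_apply, sum_config_succ, Fin.sum_univ_two]
  simp only [opB_allDown_frozen η ζ θ x ξ _ _ h, true_and, one_ne_zero, false_and, if_false,
    zero_mul, Finset.sum_const_zero, add_zero, ite_mul, Finset.sum_ite_eq', Finset.mem_univ,
    if_true]
  rw [allUp_succ, opProd_cons_up, if_pos rfl, List.map_ofFn, List.prod_ofFn, List.length_ofFn,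
    total_allDown, Finset.prod_range_succ']
  have e₁ : ∀ i : ℕ, θ - η * (-n + 2 * (i + 1) + 1) = θ + (n - 2 * ((i + 1 : ℕ) : ℂ) - 1) * η :=
    fun i => by push_cast; ring
  have e₂ : ∀ i : ℕ, θ - η * (-n + 2 * (i + 1)) = θ + (n - 2 * ((i + 1 : ℕ) : ℂ)) * η :=
    fun i => by push_cast; ring
  simp only [e₁, e₂, Nat.cast_zero, mul_zero, sub_zero, Function.comp_apply]
  ring

end Freezing

/-! ### Trigonometric identities for adding one site -/

section Trig
variable (η t u x : ℂ)

/-- Let `A`, `D` be the two diagonal blocks on the all-down state. The four identities of this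
section say that the span of `cosh(2u+t) A - cosh(2u-t) D` and `A - D` is preserved when a site is
added and `t` becomes `t + η`, with coefficients of degree at most one in `cosh(2u+η)`. -/
theorem rowStep_A_diff (ht : Complex.sinh t ≠ 0) :
    Complex.sinh (u - x) * Complex.sinh (u + x) * Complex.sinh (t - η) * Complex.sinh (t + η) /
        Complex.sinh t ^ 2 =
      -(Complex.sinh η * Complex.sinh (t + η) / (2 * Complex.sinh t ^ 2)) *
          Complex.cosh (2 * u + t) +
        (Complex.sinh (t + η) / (2 * Complex.sinh t) * Complex.cosh (2 * u + η) -
          Complex.sinh (t - η) * Complex.sinh (t + η) / (2 * Complex.sinh t ^ 2) *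
            Complex.cosh (2 * x)) := by
  field_simp
  simp only [Complex.sinh, Complex.cosh, mul_two, Complex.exp_add, sub_eq_add_neg, neg_add,
    neg_neg, Complex.exp_neg]
  field_simp
  ring

theorem rowStep_D_diff (ht : Complex.sinh t ≠ 0) :
    Complex.sinh η ^ 2 * Complex.sinh (t - u + x) * Complex.sinh (t - u - x) /
        Complex.sinh t ^ 2 - Complex.sinh (u - x + η) * Complex.sinh (u + x + η) =
      -(-(Complex.sinh η * Complex.sinh (t + η) / (2 * Complex.sinh t ^ 2)) *
          Complex.cosh (2 * u - t) +
        (Complex.sinh (t + η) / (2 * Complex.sinh t) * Complex.cosh (2 * u + η) -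
          Complex.sinh (t - η) * Complex.sinh (t + η) / (2 * Complex.sinh t ^ 2) *
            Complex.cosh (2 * x))) := by
  field_simp
  simp only [Complex.sinh, Complex.cosh, mul_two, Complex.exp_add, sub_eq_add_neg, neg_add,
    neg_neg, Complex.exp_neg]
  field_simp
  ring

theorem rowStep_A_cosh (ht : Complex.sinh t ≠ 0) :
    Complex.cosh (2 * u + (t + η)) *
      (Complex.sinh (u - x) * Complex.sinh (u + x) * Complex.sinh (t - η) * Complex.sinh (t + η) /
        Complex.sinh t ^ 2) =
      Complex.sinh (t + η) / (2 * Complex.sinh t ^ 2) *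
          (Complex.sinh (t - η) * Complex.cosh (2 * u + η) -
            Complex.sinh t * Complex.cosh (2 * x)) * Complex.cosh (2 * u + t) +
        Complex.sinh (t + η) * Complex.sinh η / (2 * Complex.sinh t ^ 2) *
          (Complex.sinh (t - η) * Complex.sinh t +
            Complex.cosh (2 * x) * Complex.cosh (2 * u + η)) := by
  field_simp
  simp only [Complex.sinh, Complex.cosh, two_mul, Complex.exp_add, sub_eq_add_neg, neg_add,
    neg_neg, Complex.exp_neg]
  field_simp
  ring

theorem rowStep_D_cosh (ht : Complex.sinh t ≠ 0) :
    Complex.cosh (2 * u + (t + η)) *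
      (Complex.sinh η ^ 2 * Complex.sinh (t - u + x) * Complex.sinh (t - u - x) /
        Complex.sinh t ^ 2) -
      Complex.cosh (2 * u - (t + η)) * (Complex.sinh (u - x + η) * Complex.sinh (u + x + η)) =
      -(Complex.sinh (t + η) / (2 * Complex.sinh t ^ 2) *
          (Complex.sinh (t - η) * Complex.cosh (2 * u + η) -
            Complex.sinh t * Complex.cosh (2 * x)) * Complex.cosh (2 * u - t) +
        Complex.sinh (t + η) * Complex.sinh η / (2 * Complex.sinh t ^ 2) *
          (Complex.sinh (t - η) * Complex.sinh t +
            Complex.cosh (2 * x) * Complex.cosh (2 * u + η))) := by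
  field_simp
  simp only [Complex.sinh, Complex.cosh, two_mul, Complex.exp_add, sub_eq_add_neg, neg_add,
    neg_neg, Complex.exp_neg]
  field_simp
  ring

end Trig

/-! ### Polynomial dependence on the first spectral parameter -/

section TopRow

open Polynomial

theorem degree_linear_mul_lt {n : ℕ} {p : ℂ[X]} (a b : ℂ) (hp : p.degree < n) :
    ((C a * X + C b) * p).degree < ((n + 1 : ℕ) : WithBot ℕ) := by
  by_cases h : p = 0
  · simp [h]
  · refine (degree_mul_le _ _).trans_lt ?_
    refine (add_le_add_left degree_linear_le _).trans_lt ?_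
    rw [degree_eq_natDegree h] at hp ⊢
    norm_cast at hp ⊢
    omega

theorem degree_C_mul_lt {n : ℕ} {p : ℂ[X]} (a : ℂ) (hp : p.degree < n) :
    (C a * p).degree < n := by
  by_cases h : a = 0
  · simp [h]
  · rwa [degree_C_mul h]

theorem block_up_allDown_cons {n : ℕ} (η ζ θ x : ℂ) (ξ : Fin n → ℂ) (u : ℂ) :
    block η ζ θ (Fin.cons x ξ : Fin (n + 1) → ℂ) u 0 0 (allDown (n + 1)) (allDown (n + 1)) =
      Complex.sinh (u - x) * Complex.sinh (u + x) * Complex.sinh (θ + n * η - η) *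
          Complex.sinh (θ + n * η + η) / Complex.sinh (θ + n * η) ^ 2 *
          block η ζ θ ξ u 0 0 (allDown n) (allDown n) +
        Complex.sinh η ^ 2 * Complex.sinh (θ + n * η - u + x) * Complex.sinh (θ + n * η - u - x) /
          Complex.sinh (θ + n * η) ^ 2 * block η ζ θ ξ u 1 1 (allDown n) (allDown n) := by
  have e : θ - η * total (allDown n) = θ + n * η := by rw [total_allDown]; ring
  have e₁ : θ + n * η - u + x = θ + n * η - (u - x) := by ring
  have e₂ : θ + n * η - u - x = θ + n * η - (u + x) := by ring
  unfold block
  rw [allDown_succ, doubleRow_cons, e, e₁, e₂]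
  simp [Fin.sum_univ_two, RMatrix_zero_entries, RMatrix_up_down_diag, RMatrix_up_down_flip,
    RMatrix_down_up_diag]
  ring

theorem block_down_allDown_cons {n : ℕ} (η ζ θ x : ℂ) (ξ : Fin n → ℂ) (u : ℂ) :
    block η ζ θ (Fin.cons x ξ : Fin (n + 1) → ℂ) u 1 1 (allDown (n + 1)) (allDown (n + 1)) =
      Complex.sinh (u - x + η) * Complex.sinh (u + x + η) *
        block η ζ θ ξ u 1 1 (allDown n) (allDown n) := by
  rw [block_down_allDown, block_down_allDown, Fin.prod_univ_succ]
  simp only [Fin.cons_zero, Fin.cons_succ]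
  ring

/-- The two combinations of the diagonal entries of the double row monodromy matrix on the state
with all spins down that are, up to the factor `sinh 2u`, polynomials in `cosh (2u + η)`. -/
theorem exists_polynomial_block_allDown {n : ℕ} (η ζ θ : ℂ) (ξ : Fin n → ℂ)
    (hθ : ∀ m : ℕ, m < n → Complex.sinh (θ + m * η) ≠ 0) :
    ∃ P Q : ℂ[X], P.degree < (n + 1 : ℕ) ∧ Q.degree < (n + 1 : ℕ) ∧
      ∀ u, Complex.sinh (θ + ζ + u) ≠ 0 → Complex.sinh (ζ + u) ≠ 0 →
        Complex.sinh (θ + ζ + u) * Complex.sinh (ζ + u) *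
            (Complex.cosh (2 * u + (θ + n * η)) * block η ζ θ ξ u 0 0 (allDown n) (allDown n) -
              Complex.cosh (2 * u - (θ + n * η)) * block η ζ θ ξ u 1 1 (allDown n) (allDown n)) =
          Complex.sinh (2 * u) * P.eval (Complex.cosh (2 * u + η)) ∧
        Complex.sinh (θ + ζ + u) * Complex.sinh (ζ + u) *
            (block η ζ θ ξ u 0 0 (allDown n) (allDown n) -
              block η ζ θ ξ u 1 1 (allDown n) (allDown n)) =
          Complex.sinh (2 * u) * Q.eval (Complex.cosh (2 * u + η)) := by
  induction n with
  | zero =>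
    refine ⟨C (Complex.cosh (θ + 2 * ζ) * Complex.sinh θ), C (Complex.sinh θ),
      degree_C_lt, degree_C_lt, fun u h₁ h₂ => ?_⟩
    unfold block
    simp only [doubleRow_zero, if_true, boundaryWeight, eval_C, Nat.cast_zero, zero_mul, add_zero,
      cons_val_zero, cons_val_one]
    constructor
    all_goals
      field_simp
      simp only [Complex.sinh, Complex.cosh, mul_two, Complex.exp_add, sub_eq_add_neg,
        neg_add, neg_neg, Complex.exp_neg]
      field_simp
      ring
  | succ n ih =>
    obtain ⟨P, Q, hP, hQ, h⟩ := ih (Fin.tail ξ) fun m hm => hθ m (hm.trans n.lt_succ_self)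
    have ht := hθ n n.lt_succ_self
    obtain ⟨x, ξ, rfl⟩ : ∃ x ξ', ξ = Fin.cons x ξ' := ⟨_, _, (Fin.cons_self_tail ξ).symm⟩
    rw [Fin.tail_cons] at h
    simp only [block_up_allDown_cons, block_down_allDown_cons]
    have et : θ + ((n + 1 : ℕ) : ℂ) * η = θ + n * η + η := by push_cast; ring
    rw [et]
    generalize θ + n * η = t at *
    -- The new pair is a two by two matrix of linear polynomials applied to `(P, Q)`; its entries
    -- are read off from the `rowStep` identities, with `X` standing for `cosh(2u+η)`.
    refine ⟨(C (Complex.sinh (t + η) / (2 * Complex.sinh t ^ 2) * Complex.sinh (t - η)) * X +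
          C (-(Complex.sinh (t + η) / (2 * Complex.sinh t ^ 2) * Complex.sinh t *
            Complex.cosh (2 * x)))) * P +
        (C (Complex.sinh (t + η) * Complex.sinh η / (2 * Complex.sinh t ^ 2) *
            Complex.cosh (2 * x)) * X +
          C (Complex.sinh (t + η) * Complex.sinh η / (2 * Complex.sinh t ^ 2) *
            (Complex.sinh (t - η) * Complex.sinh t))) * Q,
      (C 0 * X + C (-(Complex.sinh η * Complex.sinh (t + η) / (2 * Complex.sinh t ^ 2)))) * P +
        (C (Complex.sinh (t + η) / (2 * Complex.sinh t)) * X +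
          C (-(Complex.sinh (t - η) * Complex.sinh (t + η) / (2 * Complex.sinh t ^ 2) *
            Complex.cosh (2 * x)))) * Q,
      (degree_add_le _ _).trans_lt (max_lt (degree_linear_mul_lt _ _ hP)
        (degree_linear_mul_lt _ _ hQ)),
      (degree_add_le _ _).trans_lt (max_lt (degree_linear_mul_lt _ _ hP)
        (degree_linear_mul_lt _ _ hQ)), fun u h₁ h₂ => ?_⟩
    obtain ⟨hP', hQ'⟩ := h u h₁ h₂
    simp only [eval_add, eval_mul, eval_C, eval_X]
    have e₁ := rowStep_A_diff η t u x ht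
    have e₂ := rowStep_D_diff η t u x ht
    have e₃ := rowStep_A_cosh η t u x ht
    have e₄ := rowStep_D_cosh η t u x ht
    generalize block η ζ θ ξ u 0 0 (allDown n) (allDown n) = A at *
    generalize block η ζ θ ξ u 1 1 (allDown n) (allDown n) = D at *
    constructor
    · linear_combination
        (Complex.sinh (t + η) / (2 * Complex.sinh t ^ 2) *
          (Complex.sinh (t - η) * Complex.cosh (2 * u + η) -
            Complex.sinh t * Complex.cosh (2 * x))) * hP' +
        (Complex.sinh (t + η) * Complex.sinh η / (2 * Complex.sinh t ^ 2) *
          (Complex.sinh (t - η) * Complex.sinh t +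
            Complex.cosh (2 * x) * Complex.cosh (2 * u + η))) * hQ' +
        Complex.sinh (θ + ζ + u) * Complex.sinh (ζ + u) * A * e₃ +
        Complex.sinh (θ + ζ + u) * Complex.sinh (ζ + u) * D * e₄
    · linear_combination
        (-(Complex.sinh η * Complex.sinh (t + η) / (2 * Complex.sinh t ^ 2))) * hP' +
        (Complex.sinh (t + η) / (2 * Complex.sinh t) * Complex.cosh (2 * u + η) -
          Complex.sinh (t - η) * Complex.sinh (t + η) / (2 * Complex.sinh t ^ 2) *
            Complex.cosh (2 * x)) * hQ' +
        Complex.sinh (θ + ζ + u) * Complex.sinh (ζ + u) * A * e₁ +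
        Complex.sinh (θ + ζ + u) * Complex.sinh (ζ + u) * D * e₂

theorem opB_allDown_cons_down {n : ℕ} (η ζ θ x : ℂ) (ξ : Fin n → ℂ) (u : ℂ) (τ : Config n) :
    opB η ζ θ (Fin.cons x ξ : Fin (n + 1) → ℂ) u (allDown (n + 1)) (Fin.cons 1 τ) =
      Complex.sinh (θ + n * η - η) / Complex.sinh (θ + n * η) *
        (Complex.sinh (u - x) * Complex.sinh (u + x + η)) * opB η ζ θ ξ u (allDown n) τ := by
  have e : θ - η * total (allDown n) = θ + n * η := by rw [total_allDown]; ring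
  have h := block_diag_allDown η ζ θ ξ u 1 (τ := τ)
  unfold opB
  rw [allDown_succ, doubleRow_cons, e]
  simp [Fin.sum_univ_two, RMatrix_zero_entries, RMatrix_up_down_diag, RMatrix_up_down_flip,
    RMatrix_down_down]
  ring

/-- The first spin is flipped either on the way out, with `D` inside, or on the way back, with `A`
inside. Product-to-sum formulas reduce the two contributions to the two combinations already known
to be polynomial. -/
theorem opB_allDown_cons_up {n : ℕ} (η ζ θ x : ℂ) (ξ : Fin n → ℂ) (u : ℂ) (τ : Config n) :
    opB η ζ θ (Fin.cons x ξ : Fin (n + 1) → ℂ) u (allDown (n + 1)) (Fin.cons 0 τ) =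
      if τ = allDown n then
        Complex.sinh η * Complex.sinh (θ + n * η - η) / (2 * Complex.sinh (θ + n * η) ^ 2) *
          (Complex.cosh (2 * u + (θ + n * η)) * block η ζ θ ξ u 0 0 (allDown n) (allDown n) -
            Complex.cosh (2 * u - (θ + n * η)) * block η ζ θ ξ u 1 1 (allDown n) (allDown n) -
            Complex.cosh (θ + n * η + 2 * x) * (block η ζ θ ξ u 0 0 (allDown n) (allDown n) -
              block η ζ θ ξ u 1 1 (allDown n) (allDown n)))
      else 0 := by
  have e : θ - η * total (allDown n) = θ + n * η := by rw [total_allDown]; ring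
  have h₀ := block_diag_allDown η ζ θ ξ u 0 (τ := τ)
  have h₁ := block_diag_allDown η ζ θ ξ u 1 (τ := τ)
  unfold opB
  unfold block at *
  rw [allDown_succ, doubleRow_cons, e]
  split_ifs with hτ
  · subst hτ
    rw [e]
    have p₁ : 2 * (Complex.sinh (u - x) * Complex.sinh (θ + n * η + (u + x))) =
        Complex.cosh (2 * u + (θ + n * η)) - Complex.cosh (θ + n * η + 2 * x) := by
      generalize θ + n * η = t
      simp only [Complex.sinh, Complex.cosh, two_mul, Complex.exp_add, sub_eq_add_neg,
        neg_add, neg_neg, Complex.exp_neg]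
      field_simp
      ring
    have p₂ : 2 * (Complex.sinh (u + x) * Complex.sinh (θ + n * η - (u - x))) =
        Complex.cosh (θ + n * η + 2 * x) - Complex.cosh (2 * u - (θ + n * η)) := by
      generalize θ + n * η = t
      simp only [Complex.sinh, Complex.cosh, two_mul, Complex.exp_add, sub_eq_add_neg,
        neg_add, neg_neg, Complex.exp_neg]
      field_simp
      ring
    simp [Fin.sum_univ_two, RMatrix_zero_entries, RMatrix_up_down_diag, RMatrix_up_down_flip,
      RMatrix_down_up_flip]
    generalize doubleRow η ζ θ ξ u (0, allDown n) (0, allDown n) = A at *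
    generalize doubleRow η ζ θ ξ u (1, allDown n) (1, allDown n) = D at *
    linear_combination
      Complex.sinh η * Complex.sinh (θ + n * η - η) / (2 * Complex.sinh (θ + n * η) ^ 2) *
        (A * p₁ + D * p₂)
  · simp [Fin.sum_univ_two, RMatrix_zero_entries, RMatrix_up_down_diag, RMatrix_up_down_flip,
      h₀ hτ, h₁ hτ]

/-- The dependence on the spectral parameter of the entries of `ℬ` in the row of the state with all
spins down. -/
theorem exists_polynomial_opB_allDown {n : ℕ} (η ζ θ : ℂ) (ξ : Fin n → ℂ)
    (hθ : ∀ m : ℕ, m < n → Complex.sinh (θ + m * η) ≠ 0) (τ : Config n) :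
    ∃ p : ℂ[X], p.degree < n ∧
      ∀ u, Complex.sinh (θ + ζ + u) ≠ 0 → Complex.sinh (ζ + u) ≠ 0 →
        Complex.sinh (θ + ζ + u) * Complex.sinh (ζ + u) * opB η ζ θ ξ u (allDown n) τ =
          Complex.sinh (2 * u) * p.eval (Complex.cosh (2 * u + η)) := by
  induction n with
  | zero =>
    refine ⟨0, by simp, fun u _ _ => ?_⟩
    unfold opB
    simp [doubleRow_zero]
  | succ n ih =>
    have hθ' : ∀ m : ℕ, m < n → Complex.sinh (θ + m * η) ≠ 0 :=
      fun m hm => hθ m (hm.trans n.lt_succ_self)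
    obtain ⟨x, ξ, rfl⟩ : ∃ x ξ', ξ = Fin.cons x ξ' := ⟨_, _, (Fin.cons_self_tail ξ).symm⟩
    obtain ⟨t, τ, rfl⟩ : ∃ r ρ, τ = Fin.cons r ρ := ⟨_, _, (Fin.cons_self_tail τ).symm⟩
    fin_cases t
    · simp only [Fin.zero_eta, opB_allDown_cons_up]
      split_ifs with hτ
      · obtain ⟨P, Q, hP, hQ, h⟩ := exists_polynomial_block_allDown η ζ θ ξ hθ'
        refine ⟨C (Complex.sinh η * Complex.sinh (θ + n * η - η) /
            (2 * Complex.sinh (θ + n * η) ^ 2)) * P +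
          C (-(Complex.sinh η * Complex.sinh (θ + n * η - η) /
            (2 * Complex.sinh (θ + n * η) ^ 2) * Complex.cosh (θ + n * η + 2 * x))) * Q,
          (degree_add_le _ _).trans_lt (max_lt (degree_C_mul_lt _ hP) (degree_C_mul_lt _ hQ)),
          fun u h₁ h₂ => ?_⟩
        obtain ⟨hP', hQ'⟩ := h u h₁ h₂
        simp only [eval_add, eval_mul, eval_C]
        linear_combination Complex.sinh η * Complex.sinh (θ + n * η - η) /
            (2 * Complex.sinh (θ + n * η) ^ 2) *
            (hP' - Complex.cosh (θ + n * η + 2 * x) * hQ')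
      · exact ⟨0, by simp, fun u _ _ => by simp⟩
    · obtain ⟨p, hp, h⟩ := ih ξ hθ' τ
      refine ⟨(C (Complex.sinh (θ + n * η - η) / Complex.sinh (θ + n * η) / 2) * X +
        C (-(Complex.sinh (θ + n * η - η) / Complex.sinh (θ + n * η) / 2 *
          Complex.cosh (2 * x + η)))) * p, degree_linear_mul_lt _ _ hp, fun u h₁ h₂ => ?_⟩
      have e : 2 * (Complex.sinh (u - x) * Complex.sinh (u + x + η)) =
          Complex.cosh (2 * u + η) - Complex.cosh (2 * x + η) := by
        simp only [Complex.sinh, Complex.cosh, two_mul, Complex.exp_add, sub_eq_add_neg,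
          neg_add, neg_neg, Complex.exp_neg]
        field_simp
        ring
      simp only [Fin.mk_one, opB_allDown_cons_down, eval_add, eval_mul, eval_C, eval_X]
      linear_combination Complex.sinh (θ + n * η - η) / Complex.sinh (θ + n * η) / 2 *
        (Complex.cosh (2 * u + η) - Complex.cosh (2 * x + η)) * h u h₁ h₂ +
        Complex.sinh (θ + n * η - η) / Complex.sinh (θ + n * η) / 2 *
        Complex.sinh (θ + ζ + u) * Complex.sinh (ζ + u) * opB η ζ θ ξ u (allDown n) τ * e

/-- Only the leftmost factor `ℬ(u)` involves `u`, and only its all-down row enters; the other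
factors supply constant coefficients. -/
theorem exists_polynomial_partitionFunction {n : ℕ} (η ζ θ : ℂ) (lam : Fin n → ℂ)
    (ξ : Fin (n + 1) → ℂ) (hθ : ∀ m : ℕ, m < n + 1 → Complex.sinh (θ + m * η) ≠ 0) :
    ∃ p : ℂ[X], p.degree < (n + 1 : ℕ) ∧
      ∀ u, Complex.sinh (θ + ζ + u) ≠ 0 → Complex.sinh (ζ + u) ≠ 0 →
        Complex.sinh (θ + ζ + u) * Complex.sinh (ζ + u) *
            partitionFunction η ζ θ (Fin.cons u lam : Fin (n + 1) → ℂ) ξ =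
          Complex.sinh (2 * u) * p.eval (Complex.cosh (2 * u + η)) := by
  choose p hp h using exists_polynomial_opB_allDown η ζ θ ξ hθ
  refine ⟨∑ τ, C (opProd η ζ θ ξ (List.ofFn lam) τ (allUp (n + 1))) * p τ,
    (degree_sum_le _ _).trans_lt ?_, fun u h₁ h₂ => ?_⟩
  · rw [Finset.sup_lt_iff (bot_lt_iff_ne_bot.mpr WithBot.coe_ne_bot)]
    exact fun τ _ => degree_C_mul_lt _ (hp τ)
  · rw [partitionFunction_eq_opProd, List.ofFn_cons, opProd_cons, mul_apply, eval_finsetSum,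
      Finset.mul_sum, Finset.mul_sum]
    refine Finset.sum_congr rfl fun τ _ => ?_
    rw [eval_mul, eval_C]
    linear_combination opProd η ζ θ ξ (List.ofFn lam) τ (allUp (n + 1)) * h τ u h₁ h₂

end TopRow

/-! ### The closed form: symmetry and recursion -/

section ClosedForm

/-- Up to row and column factors, `M` is the matrix of inverses of `fac`. With these denominators
cleared, the closed form makes sense at `u = ±x`, where it will be interpolated. Also `fac` is even
in `x` and invariant under `u ↦ -u - η`. -/
noncomputable def fac (η u x : ℂ) : ℂ :=
  Complex.sinh (u + x) * Complex.sinh (u - x) * Complex.sinh (u + x + η) *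
    Complex.sinh (u - x + η)

/-- The determinant of the matrix `1 / fac (λᵢ, ξⱼ)`, multiplied by all the denominators. -/
noncomputable def detNumer {n : ℕ} (η : ℂ) (lam ξ : Fin n → ℂ) : ℂ :=
  (of fun i j => ∏ k, if k = j then 1 else fac η (lam i) (ξ k)).det

noncomputable def inhomVandermonde {n : ℕ} (ξ : Fin n → ℂ) : ℂ :=
  ∏ i, ∏ j ∈ Finset.Ioi i, Complex.sinh (ξ j + ξ i) * Complex.sinh (ξ j - ξ i)

noncomputable def spectralVandermonde {n : ℕ} (η : ℂ) (lam : Fin n → ℂ) : ℂ :=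
  ∏ i, ∏ j ∈ Finset.Ioi i, Complex.sinh (lam j - lam i) * Complex.sinh (lam j + lam i + η)

noncomputable def heightFactor (η θ : ℂ) (n : ℕ) : ℂ :=
  ∏ i ∈ Finset.range n,
    Complex.sinh (θ - (i + 1) * η) / Complex.sinh (θ + (n - 2 * i - 1) * η)

/-- The value of the partition function. -/
noncomputable def closedForm {n : ℕ} (η ζ θ : ℂ) (lam ξ : Fin n → ℂ) : ℂ :=
  (-1) ^ n.choose 2 *
    (∏ i, Complex.sinh (2 * lam i) * Complex.sinh η /
      (Complex.sinh (θ + ζ + lam i) * Complex.sinh (ζ + lam i))) *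
    (∏ j, Complex.sinh (θ + ζ + ξ j) * Complex.sinh (ζ - ξ j)) * heightFactor η θ n *
    detNumer η lam ξ / (inhomVandermonde ξ * spectralVandermonde η lam)

/-- Since `sinh(a+b) sinh(a-b) = (cosh 2a - cosh 2b)/2`, this is a genuine Vandermonde determinant,
hence antisymmetric; its sign cancels that of `detNumer` in `closedForm_comp`. -/
theorem inhomVandermonde_eq_det {n : ℕ} (ξ : Fin n → ℂ) :
    inhomVandermonde ξ = (vandermonde fun j => Complex.cosh (2 * ξ j) / 2).det := by
  rw [det_vandermonde, inhomVandermonde]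
  refine Finset.prod_congr rfl fun i _ => Finset.prod_congr rfl fun j _ => ?_
  simp only [Complex.sinh, Complex.cosh, two_mul, Complex.exp_add, sub_eq_add_neg,
    neg_add, neg_neg, Complex.exp_neg]
  field_simp
  ring

theorem inhomVandermonde_comp {n : ℕ} (ξ : Fin n → ℂ) (σ : Equiv.Perm (Fin n)) :
    inhomVandermonde (ξ ∘ σ) = (Equiv.Perm.sign σ : ℤ) * inhomVandermonde ξ := by
  rw [inhomVandermonde_eq_det, inhomVandermonde_eq_det, ← det_permute]
  rfl

theorem detNumer_comp {n : ℕ} (η : ℂ) (lam ξ : Fin n → ℂ) (σ : Equiv.Perm (Fin n)) :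
    detNumer η lam (ξ ∘ σ) = (Equiv.Perm.sign σ : ℤ) * detNumer η lam ξ := by
  rw [detNumer, detNumer, ← det_permute']
  refine congrArg det (Matrix.ext fun i j => ?_)
  rw [submatrix_apply, of_apply, of_apply,
    ← Equiv.prod_comp σ fun k => if k = σ j then 1 else fac η (lam (id i)) (ξ k)]
  simp

theorem closedForm_comp {n : ℕ} (η ζ θ : ℂ) (lam ξ : Fin n → ℂ) (σ : Equiv.Perm (Fin n)) :
    closedForm η ζ θ lam (ξ ∘ σ) = closedForm η ζ θ lam ξ := by
  have h : ((Equiv.Perm.sign σ : ℤ) : ℂ) ≠ 0 := by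
    exact_mod_cast (Equiv.Perm.sign σ).ne_zero
  have e : ∏ j, Complex.sinh (θ + ζ + (ξ ∘ σ) j) * Complex.sinh (ζ - (ξ ∘ σ) j) =
      ∏ j, Complex.sinh (θ + ζ + ξ j) * Complex.sinh (ζ - ξ j) :=
    Equiv.prod_comp σ fun j => Complex.sinh (θ + ζ + ξ j) * Complex.sinh (ζ - ξ j)
  rw [closedForm, closedForm, inhomVandermonde_comp, detNumer_comp, e, mul_left_comm,
    mul_assoc ((Equiv.Perm.sign σ : ℤ) : ℂ), mul_div_mul_left _ _ h]

theorem inhomVandermonde_cons {n : ℕ} (x : ℂ) (ξ : Fin n → ℂ) :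
    inhomVandermonde (Fin.cons x ξ : Fin (n + 1) → ℂ) =
      (∏ k, Complex.sinh (ξ k + x) * Complex.sinh (ξ k - x)) * inhomVandermonde ξ := by
  simp only [inhomVandermonde, Fin.prod_univ_succ, Fin.prod_Ioi_zero, Fin.prod_Ioi_succ,
    Fin.cons_zero, Fin.cons_succ]

theorem spectralVandermonde_cons {n : ℕ} (η u : ℂ) (lam : Fin n → ℂ) :
    spectralVandermonde η (Fin.cons u lam : Fin (n + 1) → ℂ) =
      (∏ k, Complex.sinh (lam k - u) * Complex.sinh (lam k + u + η)) *
        spectralVandermonde η lam := by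
  simp only [spectralVandermonde, Fin.prod_univ_succ, Fin.prod_Ioi_zero, Fin.prod_Ioi_succ,
    Fin.cons_zero, Fin.cons_succ]

/-- The numerators of the frozen product for `i < n` are the denominators of `heightFactor η θ n`;
the one left over, `i = n`, is the new numerator `sinh(θ - (n+1)η)`. -/
theorem heightFactor_succ (η θ : ℂ) (n : ℕ)
    (hθ : ∀ m : ℤ, |m| < n → Complex.sinh (θ + m * η) ≠ 0) :
    heightFactor η θ (n + 1) =
      (∏ i ∈ Finset.range (n + 1),
        Complex.sinh (θ + (n - 2 * i - 1) * η) / Complex.sinh (θ + (n - 2 * i) * η)) *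
        heightFactor η θ n := by
  have h0 : ∏ i ∈ Finset.range n, Complex.sinh (θ + (n - 2 * i - 1) * η) ≠ 0 := by
    refine Finset.prod_ne_zero_iff.mpr fun i hi => ?_
    rw [Finset.mem_range] at hi
    have := hθ (n - 2 * i - 1) (by rw [abs_lt]; constructor <;> omega)
    push_cast at this
    exact this
  have e : ∀ i : ℕ, ((n + 1 : ℕ) : ℂ) - 2 * i - 1 = n - 2 * i := fun i => by push_cast; ring
  have e' : θ + (n - 2 * (n : ℂ) - 1) * η = θ - (n + 1) * η := by ring
  unfold heightFactor
  simp only [Finset.prod_div_distrib, e]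
  rw [Finset.prod_range_succ (fun i : ℕ => Complex.sinh (θ - (i + 1) * η)),
    Finset.prod_range_succ (fun i : ℕ => Complex.sinh (θ + (n - 2 * i - 1) * η)), e',
    div_mul_div_comm, ← mul_div_mul_right _ _ h0]
  ring

/-- Expansion along the first row. -/
theorem detNumer_cons {n : ℕ} (η u : ℂ) (lam : Fin n → ℂ) (ξ : Fin (n + 1) → ℂ) :
    detNumer η (Fin.cons u lam : Fin (n + 1) → ℂ) ξ =
      ∑ j : Fin (n + 1), (-1) ^ (j : ℕ) * (∏ k, if k = j then 1 else fac η u (ξ k)) *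
        (of fun (i : Fin n) (l : Fin n) =>
          ∏ k, if k = j.succAbove l then 1 else fac η (lam i) (ξ k)).det := by
  rw [detNumer, det_succ_row_zero]
  rfl

theorem detNumer_cons_apply_self {n : ℕ} (η : ℂ) (lam : Fin n → ℂ) (ξ : Fin (n + 1) → ℂ)
    (i : Fin n) : detNumer η (Fin.cons (lam i) lam : Fin (n + 1) → ℂ) ξ = 0 :=
  det_zero_of_row_eq (Fin.succ_ne_zero i).symm rfl

theorem fac_self (η x : ℂ) : fac η x x = 0 := by
  simp [fac]

/-- Every entry of the first row except the first contains `fac η x x = 0`, so a single minor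
survives, and `fac η (lam i) x` comes out of each of its rows. -/
theorem detNumer_cons_cons_self {n : ℕ} (η x : ℂ) (lam ξ : Fin n → ℂ) :
    detNumer η (Fin.cons x lam : Fin (n + 1) → ℂ) (Fin.cons x ξ) =
      (∏ k, fac η x (ξ k)) * (∏ k, fac η (lam k) x) * detNumer η lam ξ := by
  rw [detNumer_cons, Fin.sum_univ_succ]
  have h : ∀ j : Fin n, (∏ k : Fin (n + 1), if k = j.succ then (1 : ℂ) else
      fac η x ((Fin.cons x ξ : Fin (n + 1) → ℂ) k)) = 0 := by
    intro j
    rw [Fin.prod_univ_succ, if_neg (Fin.succ_ne_zero j).symm, Fin.cons_zero, fac_self, zero_mul]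
  simp only [h, mul_zero, zero_mul, Finset.sum_const_zero, add_zero]
  simp only [Fin.prod_univ_succ, Fin.zero_succAbove, Fin.succ_inj, (Fin.succ_ne_zero _).symm,
    Fin.succ_ne_zero, if_true, if_false, Fin.cons_zero, Fin.cons_succ, Fin.val_zero, pow_zero,
    one_mul]
  rw [mul_assoc, detNumer, ← det_mul_column fun i => fac η (lam i) x]
  rfl

theorem closedForm_cons_cons_self {n : ℕ} (η ζ θ x : ℂ) (lam ξ : Fin n → ℂ)
    (hθ : ∀ m : ℤ, |m| < n → Complex.sinh (θ + m * η) ≠ 0)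
    (hx : Complex.sinh (θ + ζ + x) ≠ 0) (h₁ : ∀ k, Complex.sinh (ξ k + x) ≠ 0)
    (h₂ : ∀ k, Complex.sinh (ξ k - x) ≠ 0) (h₃ : ∀ k, Complex.sinh (lam k - x) ≠ 0)
    (h₄ : ∀ k, Complex.sinh (lam k + x + η) ≠ 0) :
    closedForm η ζ θ (Fin.cons x lam : Fin (n + 1) → ℂ) (Fin.cons x ξ) =
      Complex.sinh η * Complex.sinh (2 * x) * (Complex.sinh (ζ - x) / Complex.sinh (ζ + x)) *
        (∏ k, Complex.sinh (x - ξ k + η) * Complex.sinh (x + ξ k + η)) *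
        (∏ k, Complex.sinh (lam k - x + η) * Complex.sinh (lam k + x)) *
        (∏ i ∈ Finset.range (n + 1),
          Complex.sinh (θ + (n - 2 * i - 1) * η) / Complex.sinh (θ + (n - 2 * i) * η)) *
        closedForm η ζ θ lam ξ := by
  have e₁ : ∏ k, fac η x (ξ k) =
      (-1) ^ n * (∏ k, Complex.sinh (x - ξ k + η) * Complex.sinh (x + ξ k + η)) *
        ∏ k, Complex.sinh (ξ k + x) * Complex.sinh (ξ k - x) := by
    rw [← Fin.prod_const, ← Finset.prod_mul_distrib, ← Finset.prod_mul_distrib]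
    refine Finset.prod_congr rfl fun k _ => ?_
    rw [fac, ← neg_sub (ξ k) x, Complex.sinh_neg, add_comm x (ξ k)]
    ring
  have e₂ : ∏ k, fac η (lam k) x =
      (∏ k, Complex.sinh (lam k - x + η) * Complex.sinh (lam k + x)) *
        ∏ k, Complex.sinh (lam k - x) * Complex.sinh (lam k + x + η) := by
    rw [← Finset.prod_mul_distrib]
    refine Finset.prod_congr rfl fun k _ => ?_
    rw [fac]
    ring
  have n₁ : ∏ k, Complex.sinh (ξ k + x) * Complex.sinh (ξ k - x) ≠ 0 :=
    Finset.prod_ne_zero_iff.mpr fun k _ => mul_ne_zero (h₁ k) (h₂ k)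
  have n₂ : ∏ k, Complex.sinh (lam k - x) * Complex.sinh (lam k + x + η) ≠ 0 :=
    Finset.prod_ne_zero_iff.mpr fun k _ => mul_ne_zero (h₃ k) (h₄ k)
  -- The factor `(-1)^n` comes from turning each `sinh(x - ξ_k)` into `sinh(ξ_k - x)` in `e₁`.
  have hs : (-1 : ℂ) ^ (n + 1).choose 2 * (-1) ^ n = (-1) ^ n.choose 2 := by
    rw [Nat.choose_succ_succ' n 1, Nat.choose_one_right, pow_add, mul_right_comm, ← mul_pow]
    simp
  unfold closedForm
  rw [inhomVandermonde_cons, spectralVandermonde_cons, heightFactor_succ η θ n hθ,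
    detNumer_cons_cons_self, e₁, e₂, Fin.prod_univ_succ, Fin.prod_univ_succ, ← hs]
  simp only [Fin.cons_zero, Fin.cons_succ]
  generalize inhomVandermonde ξ = V
  generalize spectralVandermonde η lam = V'
  generalize detNumer η lam ξ = D
  generalize heightFactor η θ n = H
  generalize ∏ k, Complex.sinh (ξ k + x) * Complex.sinh (ξ k - x) = p₁ at *
  generalize ∏ k, Complex.sinh (lam k - x) * Complex.sinh (lam k + x + η) = p₂ at *
  generalize (∏ k, Complex.sinh (x - ξ k + η) * Complex.sinh (x + ξ k + η)) = p₃
  generalize (∏ k, Complex.sinh (lam k - x + η) * Complex.sinh (lam k + x)) = p₄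
  generalize (∏ i, Complex.sinh (2 * lam i) * Complex.sinh η /
    (Complex.sinh (θ + ζ + lam i) * Complex.sinh (ζ + lam i))) = p₅
  generalize (∏ j, Complex.sinh (θ + ζ + ξ j) * Complex.sinh (ζ - ξ j)) = p₆
  generalize (∏ i ∈ Finset.range (n + 1),
    Complex.sinh (θ + (n - 2 * i - 1) * η) / Complex.sinh (θ + (n - 2 * i) * η)) = p₇
  generalize ((-1 : ℂ) ^ (n + 1).choose 2) = c₁
  generalize ((-1 : ℂ) ^ n) = c₂
  have n₃ : p₁ * p₂ ≠ 0 := mul_ne_zero n₁ n₂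
  rw [show p₁ * V * (p₂ * V') = p₁ * p₂ * (V * V') by ring,
    show ∀ a b c : ℂ, a * b * c * (p₇ * H) * (c₂ * p₃ * p₁ * (p₄ * p₂) * D) =
      p₁ * p₂ * (a * b * c * (p₇ * H) * (c₂ * p₃ * p₄ * D)) by intros; ring,
    mul_div_mul_left _ _ n₃]
  generalize Complex.sinh (θ + ζ + x) = a at *
  generalize Complex.sinh (ζ + x) = b
  generalize Complex.sinh (ζ - x) = c
  generalize Complex.sinh (2 * x) = d
  generalize Complex.sinh η = e
  clear * - hx
  have : d * e / (a * b) * (a * c) = d * e * (c / b) := by field_simp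
  linear_combination (c₁ * p₅ * p₆ * p₇ * H * c₂ * p₃ * p₄ * D / (V * V')) * this

end ClosedForm

/-! ### Lagrange interpolation in `cosh(2u+η)` -/

section Interpolation

open Polynomial

/-- Genericity of the inhomogeneities, as needed for the interpolation. -/
structure GenericInhom {n : ℕ} (η ζ θ : ℂ) (ξ : Fin n → ℂ) : Prop where
  two_mul : ∀ j, Complex.sinh (2 * ξ j) ≠ 0
  left : ∀ j, Complex.sinh (θ + ζ + ξ j) ≠ 0
  right : ∀ j, Complex.sinh (ζ + ξ j) ≠ 0
  add : ∀ i j, i ≠ j → Complex.sinh (ξ i + ξ j) ≠ 0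
  sub : ∀ i j, i ≠ j → Complex.sinh (ξ i - ξ j) ≠ 0
  add_eta : ∀ i j, i ≠ j → Complex.sinh (ξ i + ξ j + η) ≠ 0
  sub_eta : ∀ i j, i ≠ j → Complex.sinh (ξ i - ξ j + η) ≠ 0

theorem GenericInhom.comp {n m : ℕ} {η ζ θ : ℂ} {ξ : Fin n → ℂ} (h : GenericInhom η ζ θ ξ)
    {f : Fin m → Fin n} (hf : Function.Injective f) : GenericInhom η ζ θ fun i => ξ (f i) where
  two_mul _ := h.two_mul _
  left _ := h.left _
  right _ := h.right _
  add _ _ hij := h.add _ _ (hf.ne hij)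
  sub _ _ hij := h.sub _ _ (hf.ne hij)
  add_eta _ _ hij := h.add_eta _ _ (hf.ne hij)
  sub_eta _ _ hij := h.sub_eta _ _ (hf.ne hij)

/-- The polynomial whose value at `cosh (2u + η)` is `fac η u x`. -/
noncomputable def facPoly (η x : ℂ) : ℂ[X] :=
  C (1 / 4) * ((X - C (Complex.cosh (2 * x + η))) * (X - C (Complex.cosh (2 * x - η))))

theorem eval_facPoly (η u x : ℂ) :
    (facPoly η x).eval (Complex.cosh (2 * u + η)) = fac η u x := by
  simp only [facPoly, fac, eval_mul, eval_sub, eval_X, eval_C]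
  simp only [Complex.sinh, Complex.cosh, _root_.two_mul, Complex.exp_add, sub_eq_add_neg,
    neg_add, neg_neg, Complex.exp_neg]
  field_simp
  ring

theorem natDegree_facPoly_le (η x : ℂ) : (facPoly η x).natDegree ≤ 2 := by
  unfold facPoly
  refine (natDegree_C_mul_le _ _).trans (natDegree_mul_le.trans ?_)
  rw [natDegree_X_sub_C, natDegree_X_sub_C]

theorem cosh_sub_cosh (η a b : ℂ) :
    Complex.cosh (2 * a + η) - Complex.cosh (2 * b + η) =
      2 * (Complex.sinh (a - b) * Complex.sinh (a + b + η)) := by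
  simp only [Complex.sinh, Complex.cosh, _root_.two_mul, Complex.exp_add, sub_eq_add_neg,
    neg_add, neg_neg, Complex.exp_neg]
  field_simp
  ring

/-- The closed form as a polynomial in `cosh (2u + η)`, where `u` is the first spectral
parameter. -/
theorem exists_polynomial_closedForm {n : ℕ} (η ζ θ : ℂ) (lam : Fin n → ℂ) (ξ : Fin (n + 1) → ℂ) :
    ∃ q : ℂ[X], q.natDegree ≤ 2 * n ∧
      (∀ i, q.eval (Complex.cosh (2 * lam i + η)) = 0) ∧
      ∀ u, Complex.sinh (θ + ζ + u) ≠ 0 → Complex.sinh (ζ + u) ≠ 0 →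
        (∀ k, Complex.sinh (lam k - u) * Complex.sinh (lam k + u + η) ≠ 0) →
        Complex.sinh (θ + ζ + u) * Complex.sinh (ζ + u) *
          (∏ k, Complex.sinh (lam k - u) * Complex.sinh (lam k + u + η)) *
            closedForm η ζ θ (Fin.cons u lam : Fin (n + 1) → ℂ) ξ =
          Complex.sinh (2 * u) * q.eval (Complex.cosh (2 * u + η)) := by
  set K : ℂ := (-1) ^ (n + 1).choose 2 * Complex.sinh η *
    (∏ i, Complex.sinh (2 * lam i) * Complex.sinh η /
      (Complex.sinh (θ + ζ + lam i) * Complex.sinh (ζ + lam i))) *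
    (∏ j, Complex.sinh (θ + ζ + ξ j) * Complex.sinh (ζ - ξ j)) * heightFactor η θ (n + 1) /
    (inhomVandermonde ξ * spectralVandermonde η lam) with hK
  set q : ℂ[X] := C K * ∑ j : Fin (n + 1), C ((-1) ^ (j : ℕ) *
    (of fun (i : Fin n) (l : Fin n) =>
      ∏ k, if k = j.succAbove l then 1 else fac η (lam i) (ξ k)).det) *
      ∏ k, if k = j then 1 else facPoly η (ξ k) with hq
  have hev : ∀ u, q.eval (Complex.cosh (2 * u + η)) =
      K * detNumer η (Fin.cons u lam : Fin (n + 1) → ℂ) ξ := by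
    intro u
    rw [hq, eval_mul, eval_C, eval_finsetSum, detNumer_cons]
    congr 1
    refine Finset.sum_congr rfl fun j _ => ?_
    rw [eval_mul, eval_C, eval_prod]
    simp only [apply_ite (eval (Complex.cosh (2 * u + η))), eval_one, eval_facPoly]
    ring
  refine ⟨q, ?_, fun i => ?_, fun u h₁ h₂ h₃ => ?_⟩
  · refine (natDegree_C_mul_le _ _).trans (natDegree_sum_le_of_forall_le _ _ fun j _ => ?_)
    refine (natDegree_C_mul_le _ _).trans ((natDegree_prod_le _ _).trans ?_)
    -- The product omits `k = j`, so `n` factors of degree at most `2` remain.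
    rw [Fin.sum_univ_succAbove _ j, if_pos rfl, natDegree_one, zero_add]
    refine (Finset.sum_le_sum fun i _ => ?_ : _ ≤ ∑ _i : Fin n, 2).trans (by simp [mul_comm])
    rw [if_neg (Fin.succAbove_ne j i)]
    exact natDegree_facPoly_le _ _
  -- At `u = λ_i` the determinant has two equal rows.
  · rw [hev, detNumer_cons_apply_self, mul_zero]
  · have h₄ : ∏ k, Complex.sinh (lam k - u) * Complex.sinh (lam k + u + η) ≠ 0 :=
      Finset.prod_ne_zero_iff.mpr fun k _ => h₃ k
    rw [hev, closedForm, spectralVandermonde_cons, Fin.prod_univ_succ, hK]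
    simp only [Fin.cons_zero, Fin.cons_succ]
    generalize ∏ k, Complex.sinh (lam k - u) * Complex.sinh (lam k + u + η) = v at *
    generalize detNumer η (Fin.cons u lam : Fin (n + 1) → ℂ) ξ = D
    generalize inhomVandermonde ξ = V
    generalize spectralVandermonde η lam = V'
    generalize heightFactor η θ (n + 1) = H
    generalize (∏ i, Complex.sinh (2 * lam i) * Complex.sinh η /
      (Complex.sinh (θ + ζ + lam i) * Complex.sinh (ζ + lam i))) = p
    generalize (∏ j, Complex.sinh (θ + ζ + ξ j) * Complex.sinh (ζ - ξ j)) = p'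
    generalize ((-1 : ℂ) ^ (n + 1).choose 2) = s
    generalize Complex.sinh (θ + ζ + u) = a at *
    generalize Complex.sinh (ζ + u) = b at *
    generalize Complex.sinh (2 * u) = d
    generalize Complex.sinh η = e
    clear * - h₁ h₂ h₄
    have h : a * b * v * (d * e / (a * b)) / v = d * e := by field_simp
    rw [show V * (v * V') = v * (V * V') by ring]
    linear_combination (s * p * p' * H * D / (V * V')) * h

/-- The formula for the partition function under additional genericity assumptions on the
inhomogeneities. -/
theorem partitionFunction_eq_closedForm_of_generic {n : ℕ} (η ζ θ : ℂ) (lam ξ : Fin n → ℂ)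
    (hθ : ∀ m : ℤ, |m| < (n : ℤ) → Complex.sinh (θ + m * η) ≠ 0)
    (hK₁ : ∀ i, Complex.sinh (θ + ζ + lam i) ≠ 0) (hK₂ : ∀ i, Complex.sinh (ζ + lam i) ≠ 0)
    (hsub : ∀ i j, Complex.sinh (lam i - ξ j) ≠ 0)
    (haddη : ∀ i j, Complex.sinh (lam i + ξ j + η) ≠ 0)
    (hlam : ∀ i j, i < j → Complex.sinh (lam j - lam i) ≠ 0)
    (hlamη : ∀ i j, i < j → Complex.sinh (lam j + lam i + η) ≠ 0)
    (hξ : GenericInhom η ζ θ ξ) :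
    partitionFunction η ζ θ lam ξ = closedForm η ζ θ lam ξ := by
  induction n with
  | zero =>
    rw [partitionFunction_eq_opProd, Subsingleton.elim (allUp 0) (allDown 0)]
    simp [opProd, closedForm, heightFactor, detNumer, inhomVandermonde, spectralVandermonde]
  | succ n ih =>
    obtain ⟨u, lam, rfl⟩ : ∃ x l, lam = Fin.cons x l := ⟨_, _, (Fin.cons_self_tail lam).symm⟩
    have hθ' : ∀ m : ℤ, |m| < (n : ℤ) → Complex.sinh (θ + m * η) ≠ 0 :=
      fun m hm => hθ m (by push_cast; omega)
    have hθn : ∀ m : ℕ, m < n + 1 → Complex.sinh (θ + m * η) ≠ 0 := by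
      intro m hm
      have := hθ m (by rw [Nat.abs_cast]; exact_mod_cast hm)
      exact_mod_cast this
    have hK₁' := fun i => hK₁ (Fin.succ i)
    have hK₂' := fun i => hK₂ (Fin.succ i)
    have hsub' := fun i => hsub (Fin.succ i)
    have haddη' := fun i => haddη (Fin.succ i)
    have hlam' := fun i j (h : i < j) => hlam (Fin.succ i) (Fin.succ j) (Fin.succ_lt_succ_iff.mpr h)
    have hlamη' := fun i j (h : i < j) =>
      hlamη (Fin.succ i) (Fin.succ j) (Fin.succ_lt_succ_iff.mpr h)
    have hlam₀ := fun j => hlam 0 (Fin.succ j) (Fin.succ_pos j)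
    have hlamη₀ := fun j => hlamη 0 (Fin.succ j) (Fin.succ_pos j)
    have hu₁ := hK₁ 0
    have hu₂ := hK₂ 0
    simp only [Fin.cons_zero, Fin.cons_succ] at *
    -- Both sides are unchanged when `ξ_j` is moved to the front, by the permutation
    -- `j.cycleRange.symm`; there the two frozen recursions coincide and induction applies.
    have at_inhom : ∀ j, partitionFunction η ζ θ (Fin.cons (ξ j) lam : Fin (n + 1) → ℂ) ξ =
        closedForm η ζ θ (Fin.cons (ξ j) lam : Fin (n + 1) → ℂ) ξ := by
      intro j
      have e : (Fin.cons (ξ j) fun i => ξ (j.succAbove i) : Fin (n + 1) → ℂ) =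
          ξ ∘ (j.cycleRange.symm : Equiv.Perm (Fin (n + 1))) := by
        funext i
        refine Fin.cases ?_ (fun i => ?_) i <;> simp
      rw [(Intertwined.move_to_front ξ hθ hξ.sub_eta j).partitionFunction_eq,
        ← closedForm_comp η ζ θ _ ξ j.cycleRange.symm, ← e,
        partitionFunction_frozen _ _ _ _ _ _ (hθn n n.lt_succ_self),
        closedForm_cons_cons_self _ _ _ _ _ _ hθ' (hξ.left j)
          (fun k => hξ.add _ _ (Fin.succAbove_ne j k)) (fun k => hξ.sub _ _ (Fin.succAbove_ne j k))
          (fun k => hsub' k j) (fun k => haddη' k j),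
        ih lam _ hθ' hK₁' hK₂' (fun i k => hsub' i _) (fun i k => haddη' i _) hlam' hlamη'
          (hξ.comp (Fin.succAbove_right_injective (p := j)))]
    obtain ⟨p, hp, hpu⟩ := exists_polynomial_partitionFunction η ζ θ lam ξ hθn
    obtain ⟨q, hq, hq₀, hqu⟩ := exists_polynomial_closedForm η ζ θ lam ξ
    -- The product is the `u`-dependent part of `spectralVandermonde`, written in `X = cosh(2u+η)`.
    -- Multiplying `p` by it avoids having to divide `q`.
    set r : ℂ[X] := p * ∏ i, C (1 / 2) * (C (Complex.cosh (2 * lam i + η)) - X) with hr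
    have hev : ∀ x, r.eval (Complex.cosh (2 * x + η)) = p.eval (Complex.cosh (2 * x + η)) *
        ∏ k, Complex.sinh (lam k - x) * Complex.sinh (lam k + x + η) := by
      intro x
      rw [hr, eval_mul, eval_prod]
      congr 1
      refine Finset.prod_congr rfl fun k _ => ?_
      rw [eval_mul, eval_sub, eval_C, eval_C, eval_X, cosh_sub_cosh]
      ring
    have hrdeg : r.natDegree ≤ 2 * n := by
      have h₁ : p.natDegree ≤ n := by
        rw [natDegree_le_iff_degree_le]
        exact Order.lt_succ_iff.mp hp
      have h₂ : (∏ i, C (1 / 2) * (C (Complex.cosh (2 * lam i + η)) - X)).natDegree ≤ n := by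
        refine (natDegree_prod_le _ _).trans
          ((Finset.sum_le_sum fun i _ => ?_ : _ ≤ ∑ _i : Fin n, 1).trans (by simp))
        refine (natDegree_C_mul_le _ _).trans ((natDegree_sub_le _ _).trans ?_)
        simp
      exact natDegree_mul_le.trans (by omega)
    have hrq : r = q := by
      -- There are `2n + 1` distinct nodes, `n + 1` from the `ξ`'s and `n` from the remaining `λ`'s,
      -- for two polynomials of degree at most `2n`.
      refine eq_of_degrees_lt_of_eval_index_eq (ι := Fin (n + 1) ⊕ Fin n) Finset.univ
        (v := Sum.elim (fun j => Complex.cosh (2 * ξ j + η))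
          fun i => Complex.cosh (2 * lam i + η)) ?_ ?_ ?_ ?_
      · refine Function.Injective.injOn (Function.Injective.sumElim ?_ ?_ ?_)
        · intro i j hij
          by_contra hne
          rw [← sub_eq_zero, cosh_sub_cosh] at hij
          exact mul_ne_zero two_ne_zero (mul_ne_zero (hξ.sub i j hne) (hξ.add_eta i j hne)) hij
        · intro i j hij
          by_contra hne
          rcases lt_or_gt_of_ne hne with h | h
          · have hij := hij.symm
            rw [← sub_eq_zero, cosh_sub_cosh] at hij
            exact mul_ne_zero two_ne_zero (mul_ne_zero (hlam' i j h) (hlamη' i j h)) hij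
          · rw [← sub_eq_zero, cosh_sub_cosh] at hij
            exact mul_ne_zero two_ne_zero (mul_ne_zero (hlam' j i h) (hlamη' j i h)) hij
        · intro j i hij
          have hij := hij.symm
          rw [← sub_eq_zero, cosh_sub_cosh] at hij
          exact mul_ne_zero two_ne_zero (mul_ne_zero (hsub' i j) (haddη' i j)) hij
      · refine degree_le_natDegree.trans_lt ?_
        simp only [Finset.card_univ, Fintype.card_sum, Fintype.card_fin]
        exact_mod_cast (by omega : r.natDegree < n + 1 + n)
      · refine degree_le_natDegree.trans_lt ?_
        simp only [Finset.card_univ, Fintype.card_sum, Fintype.card_fin]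
        exact_mod_cast (by omega : q.natDegree < n + 1 + n)
      · rintro (j | i) -
        · simp only [Sum.elim_inl]
          have h₁ := hpu (ξ j) (hξ.left j) (hξ.right j)
          have h₂ := hqu (ξ j) (hξ.left j) (hξ.right j)
            fun k => mul_ne_zero (hsub' k j) (haddη' k j)
          rw [at_inhom j] at h₁
          rw [hev]
          apply mul_left_cancel₀ (hξ.two_mul j)
          linear_combination h₂ - (∏ k, Complex.sinh (lam k - ξ j) *
            Complex.sinh (lam k + ξ j + η)) * h₁
        · simp only [Sum.elim_inr]
          rw [hq₀, hev, Finset.prod_eq_zero (Finset.mem_univ i) (by simp), mul_zero]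
    have h₃ : ∀ k, Complex.sinh (lam k - u) * Complex.sinh (lam k + u + η) ≠ 0 :=
      fun k => mul_ne_zero (hlam₀ k) (hlamη₀ k)
    have h₄ := hpu u hu₁ hu₂
    have h₅ := hqu u hu₁ hu₂ h₃
    rw [← hrq, hev] at h₅
    have h₆ : Complex.sinh (θ + ζ + u) * Complex.sinh (ζ + u) *
        ∏ k, Complex.sinh (lam k - u) * Complex.sinh (lam k + u + η) ≠ 0 :=
      mul_ne_zero (mul_ne_zero hu₁ hu₂) (Finset.prod_ne_zero_iff.mpr fun k _ => h₃ k)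
    apply mul_left_cancel₀ h₆
    linear_combination (∏ k, Complex.sinh (lam k - u) * Complex.sinh (lam k + u + η)) * h₄ - h₅

end Interpolation

/-! ### Removing the extra genericity of the inhomogeneities -/

section Continuity

open Filter Topology

/-- The denominators of the weights involve only the height, which is constant here, so no
non-vanishing is needed. -/
theorem continuous_RMatrix {f : ℂ → ℂ} (hf : Continuous f) (η θ : ℂ) (p q : Spin × Spin) :
    Continuous fun t => RMatrix η (f t) θ p q := by
  unfold RMatrix
  split_ifs <;> fun_prop

theorem continuous_doubleRow {n : ℕ} {ξ : ℂ → Fin n → ℂ} (hξ : Continuous ξ) (η ζ θ u : ℂ)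
    (p q : AuxConfig n) : Continuous fun t => doubleRow η ζ θ (ξ t) u p q := by
  obtain ⟨a, s⟩ := p
  obtain ⟨b, t⟩ := q
  induction n generalizing a b with
  | zero =>
    simp only [doubleRow_zero]
    exact continuous_const
  | succ n ih =>
    rw [← Fin.cons_self_tail s, ← Fin.cons_self_tail t]
    have h₀ : Continuous fun t => ξ t 0 := (continuous_apply 0).comp hξ
    have h₁ : Continuous fun t => Fin.tail (ξ t) :=
      continuous_pi fun i => (continuous_apply i.succ).comp hξ
    have e : ∀ t, ξ t = Fin.cons (ξ t 0) (Fin.tail (ξ t)) := fun t => (Fin.cons_self_tail _).symm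
    simp only [fun r p q => congrArg (fun x => doubleRow η ζ θ x u p q) (e r), doubleRow_cons]
    refine continuous_finsetSum _ fun d _ => continuous_finsetSum _ fun m _ =>
      continuous_finsetSum _ fun c _ => ?_
    exact ((continuous_RMatrix (continuous_const.sub h₀) _ _ _ _).mul (ih h₁ _ _ _ _)).mul
      (continuous_RMatrix (continuous_const.add h₀) _ _ _ _)

theorem continuous_partitionFunction {n : ℕ} {ξ : ℂ → Fin n → ℂ} (hξ : Continuous ξ) (η ζ θ : ℂ)
    (lam : Fin n → ℂ) : Continuous fun t => partitionFunction η ζ θ lam (ξ t) := by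
  simp only [partitionFunction_eq_opProd]
  generalize List.ofFn lam = L
  generalize allDown n = s
  induction L generalizing s with
  | nil => exact continuous_const
  | cons u L ih =>
    simp only [opProd_cons, mul_apply]
    exact continuous_finsetSum _ fun r _ => (continuous_doubleRow hξ _ _ _ _ _ _).mul (ih r)

theorem continuousAt_closedForm {n : ℕ} {ξ : ℂ → Fin n → ℂ} (hξ : Continuous ξ) (η ζ θ : ℂ)
    (lam : Fin n → ℂ) (h : inhomVandermonde (ξ 0) * spectralVandermonde η lam ≠ 0) :
    ContinuousAt (fun t => closedForm η ζ θ lam (ξ t)) 0 := by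
  have hi : ∀ i, Continuous fun t => ξ t i := fun i => (continuous_apply i).comp hξ
  have hdet : Continuous fun t => detNumer η lam (ξ t) := by
    refine Continuous.matrix_det (continuous_matrix fun i j => ?_)
    change Continuous fun t => ∏ k, if k = j then (1 : ℂ) else fac η (lam i) (ξ t k)
    refine continuous_finsetProd _ fun k _ => ?_
    split_ifs
    · exact continuous_const
    · unfold fac
      fun_prop
  unfold closedForm
  refine ContinuousAt.div (by fun_prop) ?_ h
  unfold inhomVandermonde
  fun_prop

/-- The zeros of `sinh` are simple, because `cosh² = sinh² + 1`, hence isolated along any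
non-constant line. -/
theorem eventually_sinh_ne_zero (a : ℂ) {c : ℂ} (hc : c ≠ 0) :
    ∀ᶠ t in 𝓝[≠] (0 : ℂ), Complex.sinh (a + t * c) ≠ 0 := by
  by_cases ha : Complex.sinh a = 0
  · have hd : HasDerivAt (fun t : ℂ => Complex.sinh (a + t * c)) (Complex.cosh a * c) 0 := by
      have := (((hasDerivAt_id (0 : ℂ)).mul_const c).const_add a).csinh
      simpa using this
    refine hd.eventually_ne (mul_ne_zero (fun h => ?_) hc)
    have := Complex.cosh_sq a
    rw [h, ha] at this
    norm_num at this
  · have hcont : ContinuousAt (fun t : ℂ => Complex.sinh (a + t * c)) 0 := by fun_prop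
    exact (hcont.eventually_ne (by simpa using ha)).filter_mono nhdsWithin_le_nhds

/-- The direction `(1, 2, …, n)` has positive, pairwise distinct coordinates, so every expression
required to be non-zero has a non-zero slope in `t`. -/
theorem eventually_genericInhom {n : ℕ} (η ζ θ : ℂ) (ξ : Fin n → ℂ) :
    ∀ᶠ t in 𝓝[≠] (0 : ℂ), GenericInhom η ζ θ fun j => ξ j + t * ((j : ℂ) + 1) := by
  have h₁ : ∀ j : Fin n, ((j : ℕ) : ℂ) + 1 ≠ 0 := fun j => Nat.cast_add_one_ne_zero _
  have h₂ : ∀ i j : Fin n, ((i : ℕ) : ℂ) + 1 + (((j : ℕ) : ℂ) + 1) ≠ 0 := fun i j => by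
    exact_mod_cast (by omega : (i : ℕ) + 1 + ((j : ℕ) + 1) ≠ 0)
  have h₃ : ∀ i j : Fin n, i ≠ j → ((i : ℕ) : ℂ) + 1 - (((j : ℕ) : ℂ) + 1) ≠ 0 :=
    fun i j hij h => hij (Fin.ext (by exact_mod_cast (by linear_combination h : (i : ℂ) = j)))
  have ev : ∀ (ι : Type) [Finite ι] (a c : ι → ℂ), (∀ i, c i ≠ 0) →
      ∀ᶠ t in 𝓝[≠] (0 : ℂ), ∀ i, Complex.sinh (a i + t * c i) ≠ 0 := fun ι _ a c hc =>
    eventually_all.mpr fun i => eventually_sinh_ne_zero _ (hc i)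
  filter_upwards [ev (Fin n) (fun j => 2 * ξ j) (fun j => 2 * (j + 1))
      fun j => mul_ne_zero two_ne_zero (h₁ j),
    ev (Fin n) (fun j => θ + ζ + ξ j) (fun j => j + 1) h₁,
    ev (Fin n) (fun j => ζ + ξ j) (fun j => j + 1) h₁,
    ev (Fin n × Fin n) (fun p => ξ p.1 + ξ p.2) (fun p => p.1 + 1 + (p.2 + 1)) fun p => h₂ _ _,
    ev {p : Fin n × Fin n // p.1 ≠ p.2} (fun p => ξ p.1.1 - ξ p.1.2)
      (fun p => p.1.1 + 1 - (p.1.2 + 1)) fun p => h₃ _ _ p.2,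
    ev (Fin n × Fin n) (fun p => ξ p.1 + ξ p.2 + η) (fun p => p.1 + 1 + (p.2 + 1)) fun p => h₂ _ _,
    ev {p : Fin n × Fin n // p.1 ≠ p.2} (fun p => ξ p.1.1 - ξ p.1.2 + η)
      (fun p => p.1.1 + 1 - (p.1.2 + 1)) fun p => h₃ _ _ p.2] with t e₁ e₂ e₃ e₄ e₅ e₆ e₇
  have conv : ∀ {z w : ℂ}, Complex.sinh z ≠ 0 → z = w → Complex.sinh w ≠ 0 := by
    rintro z _ h rfl
    exact h
  exact
    { two_mul := fun j => conv (e₁ j) (by ring)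
      left := fun j => conv (e₂ j) (by ring)
      right := fun j => conv (e₃ j) (by ring)
      add := fun i j _ => conv (e₄ (i, j)) (by ring)
      sub := fun i j h => conv (e₅ ⟨(i, j), h⟩) (by ring)
      add_eta := fun i j _ => conv (e₆ (i, j)) (by ring)
      sub_eta := fun i j h => conv (e₇ ⟨(i, j), h⟩) (by ring) }

/-- Along a generic line through `ξ` the two sides agree for small `t ≠ 0`, and both are continuous
at `t = 0`, so the limits coincide. -/
theorem partitionFunction_eq_closedForm {n : ℕ} (η ζ θ : ℂ) (lam ξ : Fin n → ℂ)
    (hθ : ∀ m : ℤ, |m| < (n : ℤ) → Complex.sinh (θ + m * η) ≠ 0)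
    (hK₁ : ∀ i, Complex.sinh (θ + ζ + lam i) ≠ 0) (hK₂ : ∀ i, Complex.sinh (ζ + lam i) ≠ 0)
    (hξadd : ∀ i j, i < j → Complex.sinh (ξ j + ξ i) ≠ 0)
    (hξsub : ∀ i j, i < j → Complex.sinh (ξ j - ξ i) ≠ 0)
    (hlam : ∀ i j, i < j → Complex.sinh (lam j - lam i) ≠ 0)
    (hlamη : ∀ i j, i < j → Complex.sinh (lam j + lam i + η) ≠ 0) :
    partitionFunction η ζ θ lam ξ = closedForm η ζ θ lam ξ := by
  have hcont : Continuous fun (t : ℂ) (j : Fin n) => ξ j + t * ((j : ℂ) + 1) := by fun_prop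
  have hev : (fun t : ℂ => partitionFunction η ζ θ lam fun j => ξ j + t * ((j : ℂ) + 1)) =ᶠ[𝓝[≠] 0]
      fun t => closedForm η ζ θ lam fun j => ξ j + t * ((j : ℂ) + 1) := by
    have h₁ : ∀ᶠ t in 𝓝[≠] (0 : ℂ), ∀ p : Fin n × Fin n,
        Complex.sinh (lam p.1 - ξ p.2 + t * -((p.2 : ℂ) + 1)) ≠ 0 :=
      eventually_all.mpr fun p =>
        eventually_sinh_ne_zero _ (neg_ne_zero.mpr (Nat.cast_add_one_ne_zero _))
    have h₂ : ∀ᶠ t in 𝓝[≠] (0 : ℂ), ∀ p : Fin n × Fin n,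
        Complex.sinh (lam p.1 + ξ p.2 + η + t * ((p.2 : ℂ) + 1)) ≠ 0 :=
      eventually_all.mpr fun p => eventually_sinh_ne_zero _ (Nat.cast_add_one_ne_zero _)
    filter_upwards [eventually_genericInhom η ζ θ ξ, h₁, h₂] with t ht h₁ h₂
    refine partitionFunction_eq_closedForm_of_generic η ζ θ lam _ hθ hK₁ hK₂ (fun i j => ?_)
      (fun i j => ?_) hlam hlamη ht
    · convert h₁ (i, j) using 2
      ring
    · convert h₂ (i, j) using 2
      ring
  have hne : inhomVandermonde (fun j => ξ j + 0 * ((j : ℂ) + 1)) * spectralVandermonde η lam ≠ 0 := by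
    simp only [zero_mul, add_zero]
    refine mul_ne_zero ?_ ?_ <;>
      refine Finset.prod_ne_zero_iff.mpr fun i _ => Finset.prod_ne_zero_iff.mpr fun j hj => ?_
    · exact mul_ne_zero (hξadd i j (Finset.mem_Ioi.mp hj)) (hξsub i j (Finset.mem_Ioi.mp hj))
    · exact mul_ne_zero (hlam i j (Finset.mem_Ioi.mp hj)) (hlamη i j (Finset.mem_Ioi.mp hj))
  have l₁ := ((continuous_partitionFunction hcont η ζ θ lam).tendsto 0).mono_left
    (nhdsWithin_le_nhds (s := {0}ᶜ))
  have l₂ := (continuousAt_closedForm hcont η ζ θ lam hne).tendsto.mono_left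
    (nhdsWithin_le_nhds (s := {0}ᶜ))
  simpa using tendsto_nhds_unique (l₁.congr' hev) l₂

end Continuity

/-! ### Factorising the entries of `M` -/

section MMatrix

theorem MPlus_eq (η θ u x : ℂ) (hθ : Complex.sinh θ ≠ 0) (h₁ : Complex.sinh (u + x) ≠ 0)
    (h₂ : Complex.sinh (u + x + η) ≠ 0) :
    MPlus η θ u x = Complex.sinh η * Complex.sinh (θ + (u + x)) /
      (Complex.sinh θ * Complex.sinh (u - x + η) * Complex.sinh (u + x) *
        Complex.sinh (u + x + η)) := by
  have h : Complex.sinh θ * Complex.sinh (u + x + η) - Complex.sinh (θ - η) * Complex.sinh (u + x) =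
      Complex.sinh η * Complex.sinh (θ + (u + x)) := by
    generalize u + x = v
    simp only [Complex.sinh, Complex.exp_add, sub_eq_add_neg, neg_add, neg_neg, Complex.exp_neg]
    field_simp
    ring
  rw [← h, MPlus]
  -- If this common denominator vanishes, both sides are `0` by the convention for division by zero.
  by_cases h₃ : Complex.sinh (u - x + η) = 0
  · simp [h₃]
  · field_simp

theorem MMinus_eq (η θ u x : ℂ) (hθ : Complex.sinh θ ≠ 0) (h₁ : Complex.sinh (u - x) ≠ 0)
    (h₂ : Complex.sinh (u - x + η) ≠ 0) :
    MMinus η θ u x = Complex.sinh η * Complex.sinh (θ - (u - x)) /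
      (Complex.sinh θ * Complex.sinh (u + x + η) * Complex.sinh (u - x) *
        Complex.sinh (u - x + η)) := by
  have h : Complex.sinh θ * Complex.sinh (u - x + η) - Complex.sinh (θ + η) * Complex.sinh (u - x) =
      Complex.sinh η * Complex.sinh (θ - (u - x)) := by
    generalize u - x = v
    simp only [Complex.sinh, Complex.exp_add, sub_eq_add_neg, neg_add, neg_neg, Complex.exp_neg]
    field_simp
    ring
  rw [← h, MMinus]
  by_cases h₃ : Complex.sinh (u + x + η) = 0
  · simp [h₃]
  · field_simp

/-- Over the common denominator the two boundary terms add up by the addition identity `h`, in which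
`sinh θ` splits off and cancels. -/
theorem MMatrix_apply_eq {n : ℕ} (η ζ θ : ℂ) (lam ξ : Fin n → ℂ) (i j : Fin n)
    (hθ : Complex.sinh θ ≠ 0) (hK₁ : Complex.sinh (θ + ζ + lam i) ≠ 0)
    (hK₂ : Complex.sinh (ζ + lam i) ≠ 0) (hadd : Complex.sinh (lam i + ξ j) ≠ 0)
    (hsub : Complex.sinh (lam i - ξ j) ≠ 0) (haddη : Complex.sinh (lam i + ξ j + η) ≠ 0)
    (hsubη : Complex.sinh (lam i - ξ j + η) ≠ 0) :
    MMatrix η ζ θ lam ξ i j =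
      Complex.sinh (θ + ζ + ξ j) / Complex.sinh (θ + ζ + lam i) *
          (Complex.sinh (ζ - ξ j) / Complex.sinh (ζ + lam i)) *
        (Complex.sinh (2 * lam i) * Complex.sinh η /
          (Complex.sinh (lam i - ξ j + η) * Complex.sinh (lam i + ξ j + η) *
            Complex.sinh (lam i - ξ j) * Complex.sinh (lam i + ξ j))) := by
  rw [MMatrix, MPlus_eq η θ _ _ hθ hadd haddη, MMinus_eq η θ _ _ hθ hsub hsubη]
  generalize lam i = u at *
  generalize ξ j = x at *
  have h : Complex.sinh (θ + ζ - u) * Complex.sinh (ζ + u) *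
        (Complex.sinh (θ + (u + x)) * Complex.sinh (u - x)) +
      Complex.sinh (ζ - u) * Complex.sinh (θ + ζ + u) *
        (Complex.sinh (θ - (u - x)) * Complex.sinh (u + x)) =
      Complex.sinh (2 * u) * Complex.sinh θ *
        (Complex.sinh (θ + ζ + x) * Complex.sinh (ζ - x)) := by
    simp only [Complex.sinh, two_mul, Complex.exp_add, sub_eq_add_neg, neg_add, neg_neg,
      Complex.exp_neg]
    field_simp
    ring
  generalize Complex.sinh (θ + ζ - u) = a₁ at *
  generalize Complex.sinh (ζ - u) = a₂ at *
  generalize Complex.sinh (θ + ζ + u) = a₃ at *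
  generalize Complex.sinh (ζ + u) = a₄ at *
  generalize Complex.sinh (θ + (u + x)) = a₅ at *
  generalize Complex.sinh (θ - (u - x)) = a₆ at *
  generalize Complex.sinh (u + x + η) = a₇ at *
  generalize Complex.sinh (u - x + η) = a₈ at *
  generalize Complex.sinh (u + x) = a₉ at *
  generalize Complex.sinh (u - x) = b at *
  generalize Complex.sinh θ = c at *
  generalize Complex.sinh (2 * u) = d at *
  generalize Complex.sinh (θ + ζ + x) = e at *
  generalize Complex.sinh (ζ - x) = f at *
  field_simp
  linear_combination Complex.sinh η * h

theorem prod_fac_mul_det {n : ℕ} (η : ℂ) (lam ξ : Fin n → ℂ)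
    (h : ∀ i j, fac η (lam i) (ξ j) ≠ 0) :
    (∏ i, ∏ j, fac η (lam i) (ξ j)) * (of fun i j => (fac η (lam i) (ξ j))⁻¹).det =
      detNumer η lam ξ := by
  rw [← det_mul_column, detNumer]
  refine congrArg det (Matrix.ext fun i j => ?_)
  rw [of_apply, of_apply, of_apply, ← div_eq_mul_inv, div_eq_iff (h i j)]
  have : fac η (lam i) (ξ j) = ∏ k, if k = j then fac η (lam i) (ξ k) else 1 := by simp
  rw [this, ← Finset.prod_mul_distrib]
  refine Finset.prod_congr rfl fun k _ => ?_
  split_ifs <;> simp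

theorem heightFactor_eq (η θ : ℂ) (n : ℕ) :
    heightFactor η θ n = ∏ i ∈ Finset.Icc 1 n,
      Complex.sinh (θ - (i : ℂ) * η) / Complex.sinh (θ + ((n : ℂ) - 2 * (i : ℂ) + 1) * η) := by
  rw [← Finset.Ico_add_one_right_eq_Icc, Finset.prod_Ico_eq_prod_range, heightFactor,
    Nat.add_sub_cancel]
  refine Finset.prod_congr rfl fun i _ => ?_
  push_cast
  congr 2 <;> ring

end MMatrix

end SOS

/-! ### The determinant formula -/

theorem mainTheorem1 (N : ℕ) (η ζ θ : ℂ) (lam ξ : Fin N → ℂ)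
    (hθ : ∀ m : ℤ, |m| < (N : ℤ) → Complex.sinh (θ + m * η) ≠ 0)
    (hK₁ : ∀ i, Complex.sinh (θ + ζ + lam i) ≠ 0)
    (hK₂ : ∀ i, Complex.sinh (ζ + lam i) ≠ 0)
    (hadd : ∀ i j, Complex.sinh (lam i + ξ j) ≠ 0)
    (hsub : ∀ i j, Complex.sinh (lam i - ξ j) ≠ 0)
    (haddη : ∀ i j, Complex.sinh (lam i + ξ j + η) ≠ 0)
    (hsubη : ∀ i j, Complex.sinh (lam i - ξ j + η) ≠ 0)
    (hξadd : ∀ i j, i < j → Complex.sinh (ξ j + ξ i) ≠ 0)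
    (hξsub : ∀ i j, i < j → Complex.sinh (ξ j - ξ i) ≠ 0)
    (hlam : ∀ i j, i < j → Complex.sinh (lam j - lam i) ≠ 0)
    (hlamη : ∀ i j, i < j → Complex.sinh (lam j + lam i + η) ≠ 0) :
    SOS.partitionFunction η ζ θ lam ξ =
        (-1) ^ (N.choose 2) * (SOS.MMatrix η ζ θ lam ξ).det *
          (∏ i ∈ Finset.Icc 1 N,
            Complex.sinh (θ - (i : ℂ) * η) /
              Complex.sinh (θ + ((N : ℂ) - 2 * (i : ℂ) + 1) * η)) *
          ((∏ i : Fin N, ∏ j : Fin N,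
              Complex.sinh (lam i + ξ j) * Complex.sinh (lam i - ξ j) *
                Complex.sinh (lam i + ξ j + η) * Complex.sinh (lam i - ξ j + η)) /
            (∏ i : Fin N, ∏ j ∈ Finset.Ioi i,
              Complex.sinh (ξ j + ξ i) * Complex.sinh (ξ j - ξ i) *
                Complex.sinh (lam j - lam i) * Complex.sinh (lam j + lam i + η))) ∧
      ∀ i j, SOS.MMatrix η ζ θ lam ξ i j =
        Complex.sinh (θ + ζ + ξ j) / Complex.sinh (θ + ζ + lam i) *
            (Complex.sinh (ζ - ξ j) / Complex.sinh (ζ + lam i)) *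
          (Complex.sinh (2 * lam i) * Complex.sinh η /
            (Complex.sinh (lam i - ξ j + η) * Complex.sinh (lam i + ξ j + η) *
              Complex.sinh (lam i - ξ j) * Complex.sinh (lam i + ξ j))) := by
  -- `sinh θ ≠ 0` is the case `m = 0` of `hθ`, available because the index `i` forces `N > 0`.
  have hM : ∀ i j, SOS.MMatrix η ζ θ lam ξ i j = _ := fun i j =>
    SOS.MMatrix_apply_eq η ζ θ lam ξ i j
      (by simpa using hθ 0 (by simpa using i.pos)) (hK₁ i) (hK₂ i) (hadd i j)
      (hsub i j) (haddη i j) (hsubη i j)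
  refine ⟨?_, hM⟩
  have hfac : ∀ i j, SOS.fac η (lam i) (ξ j) ≠ 0 := fun i j =>
    mul_ne_zero (mul_ne_zero (mul_ne_zero (hadd i j) (hsub i j)) (haddη i j)) (hsubη i j)
  -- In the factorised entry, everything but `1 / fac` depends on `i` alone or on `j` alone, and
  -- leaves the determinant as row and column factors.
  have hdet : (SOS.MMatrix η ζ θ lam ξ).det =
      (∏ i, Complex.sinh (2 * lam i) * Complex.sinh η /
        (Complex.sinh (θ + ζ + lam i) * Complex.sinh (ζ + lam i))) *
      ((∏ j, Complex.sinh (θ + ζ + ξ j) * Complex.sinh (ζ - ξ j)) *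
        (Matrix.of fun i j => (SOS.fac η (lam i) (ξ j))⁻¹).det) := by
    rw [← Matrix.det_mul_row, ← Matrix.det_mul_column]
    refine congrArg Matrix.det (Matrix.ext fun i j => ?_)
    rw [hM, Matrix.of_apply, Matrix.of_apply, Matrix.of_apply, SOS.fac]
    simp only [div_eq_mul_inv, mul_inv]
    ring
  have hV : (∏ i : Fin N, ∏ j ∈ Finset.Ioi i,
      Complex.sinh (ξ j + ξ i) * Complex.sinh (ξ j - ξ i) *
        Complex.sinh (lam j - lam i) * Complex.sinh (lam j + lam i + η)) =
      SOS.inhomVandermonde ξ * SOS.spectralVandermonde η lam := by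
    simp only [SOS.inhomVandermonde, SOS.spectralVandermonde, ← Finset.prod_mul_distrib, mul_assoc]
  rw [SOS.partitionFunction_eq_closedForm η ζ θ lam ξ hθ hK₁ hK₂ hξadd hξsub hlam hlamη,
    SOS.closedForm, ← SOS.prod_fac_mul_det η lam ξ hfac, hdet, hV, ← SOS.heightFactor_eq]
  simp only [SOS.fac]
  ring
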